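/- Let $n\ge 1$, $\delta>0$, $\beta<n+4$ and $\ell_1,\dots,\ell_n>0$. Let $T^n=\prod_{i=1}^n[0,\ell_i]$ be the periodic torus, and for $k\in\mathbb{Z}^n$ put $\nu_k=\left(\frac{2\pi k_1}{\ell_1},\dots,\frac{2\pi k_n}{\ell_n}\right)$. For $\nu\in\mathbb{R}^n$ define the Fourier multiplier of the nonlocal Laplace operator $L=L^{\delta,\beta}$ by $$m(\nu)=c^{\delta,\beta}\int_{B_\delta(0)}\frac{\cos(\nu\cdot z)-1}{\|z\|^\beta}\,dz,\qquad c^{\delta,\beta}=\frac{2(n+2-\beta)\,\Gamma(\frac n2+1)}{\pi^{n/2}\,\delta^{n+2-\beta}},\qquad\text{if }\beta<n+2,$$ and by its extension $$m(\nu)=-\|\nu\|^2\;{}_2F_3\!\left(1,\tfrac{n+2-\beta}{2};2,\tfrac{n+2}{2},\tfrac{n+4-\beta}{2};-\tfrac14\|\nu\|^2\delta^2\right),\qquad\text{if }n+2\le\beta<n+4.$$ A periodic distribution $h$ on $T^n$ is a continuous linear functional on the smooth complex-valued functions on $\mathbb{R}^n$ that are $\ell_i$-periodic in $x_i$ for each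 $i$; its Fourier coefficients are $\hat h_k=\frac{1}{\ell_1\cdots\ell_n}\langle h,e^{-i\nu_k\cdot x}\rangle$. For $s\in\mathbb{R}$ let $H^s(T^n)$ be the set of periodic distributions $h$ with $\sum_{k\in\mathbb{Z}^n}(1+\|k\|^2)^s|\hat h_k|^2<\infty$, let $H^\infty(T^n)=\bigcap_{s\in\mathbb{R}}H^s(T^n)$, and define $LJ=\sum_{k}m(\nu_k)\hat J_k e^{i\nu_k\cdot x}$ for periodic distributions $J$. All series converge in the sense of periodic distributions. Let $0<\epsilon_1<\epsilon_2<1$, let $s\in\mathbb{R}$ and let $f\in H^s(T^n)$. Then for every fixed $t>0$ the series $$U(t)=\sum_{k\in\mathbb{Z}^n}\hat f_k\,e^{m(\nu_k)t}e^{i\nu_k\cdot x},\qquad V(t)=\sum_{k\in\mathbb{Z}^n}\hat f_k\,m(\nu_k)\,e^{m(\nu_k)t}e^{i\nu_k\cdot x}$$ define periodic distributions with $V(t)=LU(t)$, and $U(t)\in H^p(T^n)$, $V(t)\in H^r(T^n)$, where $$p=\begin{cases}s,&\beta<n,\\ s+\frac{4nt}{\delta^2}(1-\epsilon_1),&\beta=n,\\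 \infty,&\beta>n,\end{cases}\qquad r=\begin{cases}s,&\beta<n,\\ s+\frac{4nt}{\delta^2}(1-\epsilon_2),&\beta=n,\\ \infty,&\beta>n.\end{cases}$$ -/

import Mathlib

open scoped ContDiff

noncomputable section

/-- The scaling constant
`c^{δ,β} = 2 (n+2-β) Γ(n/2+1) / (π^{n/2} δ^{n+2-β})`. -/
def scalingConst (n : ℕ) (δ β : ℝ) : ℝ :=
  2 * ((n : ℝ) + 2 - β) * Real.Gamma ((n : ℝ) / 2 + 1) /
    (Real.pi ^ ((n : ℝ) / 2) * δ ^ ((n : ℝ) + 2 - β))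

/-- The generalized hypergeometric function `₂F₃(a₁, a₂; b₁, b₂, b₃; z)` as a power series,
with rising factorials `(a)_j`. -/
def hyp2F3 (a₁ a₂ b₁ b₂ b₃ z : ℝ) : ℝ :=
  ∑' j : ℕ,
    ((ascPochhammer ℝ j).eval a₁ * (ascPochhammer ℝ j).eval a₂) /
      ((ascPochhammer ℝ j).eval b₁ * (ascPochhammer ℝ j).eval b₂ *
        (ascPochhammer ℝ j).eval b₃) *
      (z ^ j / (Nat.factorial j : ℝ))

/-- The Fourier multiplier `m^{δ,β}(ν)` of the nonlocal Laplace operator on `ℝⁿ`.  For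
`β < n + 2` it is given by the integral
`c^{δ,β} ∫_{B_δ(0)} (cos(ν·z) - 1) / ‖z‖^β dz` (absolutely convergent, since the integrand is
`O(‖z‖^{2-β})`); for `β ≥ n + 2` it is the extension
`-‖ν‖² ₂F₃(1, (n+2-β)/2; 2, (n+2)/2, (n+4-β)/2; -‖ν‖²δ²/4)`. -/
def multiplier {n : ℕ} (δ β : ℝ) (ν : EuclideanSpace ℝ (Fin n)) : ℝ :=
  if β < (n : ℝ) + 2 then
    scalingConst n δ β *
      ∫ z in Metric.ball (0 : EuclideanSpace ℝ (Fin n)) δ,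
        (Real.cos (inner ℝ ν z) - 1) / ‖z‖ ^ β
  else
    -‖ν‖ ^ 2 *
      hyp2F3 1 (((n : ℝ) + 2 - β) / 2) 2 (((n : ℝ) + 2) / 2) (((n : ℝ) + 4 - β) / 2)
        (-(1 / 4) * ‖ν‖ ^ 2 * δ ^ 2)

/-- The frequency `ν_k = (2π k₁/ℓ₁, …, 2π kₙ/ℓₙ)` of the torus `∏ [0, ℓᵢ]`. -/
def torusFreq {n : ℕ} (ℓ : Fin n → ℝ) (k : Fin n → ℤ) : EuclideanSpace ℝ (Fin n) :=
  WithLp.toLp 2 fun i => 2 * Real.pi * (k i : ℝ) / ℓ i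

/-- Test functions on the torus `∏ [0, ℓᵢ]`: smooth functions `ℝⁿ → ℂ` that are `ℓᵢ`-periodic
in the `i`-th variable. -/
def TorusTestFunction {n : ℕ} (ℓ : Fin n → ℝ) : Submodule ℂ ((Fin n → ℝ) → ℂ) where
  carrier := {φ | ContDiff ℝ ∞ φ ∧ ∀ i x, φ (x + Pi.single i (ℓ i)) = φ x}
  add_mem' := by
    rintro φ ψ ⟨h1, h2⟩ ⟨h3, h4⟩
    exact ⟨h1.add h3, fun i x => by simp [h2, h4]⟩
  zero_mem' := ⟨contDiff_const, fun _ _ => rfl⟩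
  smul_mem' := by
    rintro c φ ⟨h1, h2⟩
    exact ⟨contDiff_const.smul h1, fun i x => by simp [h2]⟩

/-- The function `x ↦ e^{i ν_k · x}`. -/
def torusExpFun {n : ℕ} (ℓ : Fin n → ℝ) (k : Fin n → ℤ) (x : Fin n → ℝ) : ℂ :=
  Complex.exp (Complex.I * ((∑ i, torusFreq ℓ k i * x i : ℝ) : ℂ))

theorem torusExpFun_mem {n : ℕ} (ℓ : Fin n → ℝ) (k : Fin n → ℤ) :
    torusExpFun ℓ k ∈ TorusTestFunction ℓ := by
  refine ⟨?_, fun i x => ?_⟩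
  · have h0 : ContDiff ℝ ∞ (fun x : Fin n → ℝ => ∑ i, torusFreq ℓ k i * x i) := by
      fun_prop
    exact ContDiff.cexp (contDiff_const.mul (Complex.ofRealCLM.contDiff.comp h0))
  · by_cases h : ℓ i = 0
    · simp [h]
    · unfold torusExpFun
      have h1 : (∑ j, torusFreq ℓ k j * (x + Pi.single i (ℓ i) : Fin n → ℝ) j : ℝ)
          = (∑ j, torusFreq ℓ k j * x j) + (k i : ℝ) * (2 * Real.pi) := by
        simp only [Pi.add_apply, mul_add, Finset.sum_add_distrib]
        congr 1
        rw [Finset.sum_eq_single i]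
        · simp [torusFreq]
          field_simp
        · intro j _ hj
          simp [hj]
        · simp
      rw [h1, Complex.exp_eq_exp_iff_exists_int]
      refine ⟨k i, ?_⟩
      push_cast
      ring

/-- The test function `e^{i ν_k · x}`. -/
def torusExp {n : ℕ} (ℓ : Fin n → ℝ) (k : Fin n → ℤ) : TorusTestFunction ℓ :=
  ⟨torusExpFun ℓ k, torusExpFun_mem ℓ k⟩

/-- Periodic distributions on the torus `∏ [0, ℓᵢ]`: linear functionals on the test functions
that are continuous, i.e. bounded by a finite number of the seminorms
`φ ↦ sup_x ‖D^j φ(x)‖` of the space of test functions. -/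
structure PeriodicDistribution {n : ℕ} (ℓ : Fin n → ℝ) where
  toLinearMap : TorusTestFunction ℓ →ₗ[ℂ] ℂ
  continuous' : ∃ (N : ℕ) (C : ℝ), ∀ (φ : TorusTestFunction ℓ) (B : ℝ),
    (∀ j ≤ N, ∀ x, ‖iteratedFDeriv ℝ j (φ : (Fin n → ℝ) → ℂ) x‖ ≤ B) →
      ‖toLinearMap φ‖ ≤ C * B

namespace PeriodicDistribution

variable {n : ℕ} {ℓ : Fin n → ℝ}

/-- The Fourier coefficient `ĥ_k = |T|⁻¹ ⟨h, e^{-i ν_k · x}⟩`, where `|T| = ∏ ℓᵢ`. -/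
def fourierCoeff (h : PeriodicDistribution ℓ) (k : Fin n → ℤ) : ℂ :=
  ((∏ i, ℓ i : ℝ) : ℂ)⁻¹ * h.toLinearMap (torusExp ℓ (-k))

/-- `h = ∑_k c_k e^{i ν_k · x}` with (unconditional) convergence in the sense of distributions;
`h` is determined uniquely by the coefficients `c`. -/
def HasFourierSeries (h : PeriodicDistribution ℓ) (c : (Fin n → ℤ) → ℂ) : Prop :=
  ∀ φ : TorusTestFunction ℓ,
    HasSum (fun k : Fin n → ℤ =>
      c k * ∫ x in Set.Icc (0 : Fin n → ℝ) ℓ, torusExpFun ℓ k x * (φ : (Fin n → ℝ) → ℂ) x)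
      (h.toLinearMap φ)

/-- `W = L^{δ,β} J`, where `L^{δ,β} J = ∑_k m^{δ,β}(ν_k) Ĵ_k e^{i ν_k · x}`. -/
def IsNonlocalLaplacian (δ β : ℝ) (J W : PeriodicDistribution ℓ) : Prop :=
  W.HasFourierSeries fun k => (multiplier δ β (torusFreq ℓ k) : ℂ) * J.fourierCoeff k

end PeriodicDistribution

/-- `H^s(T)`: periodic distributions with `∑_k (1 + ‖k‖²)^s |ĥ_k|² < ∞`. -/
def torusSobolev {n : ℕ} (ℓ : Fin n → ℝ) (s : ℝ) : Set (PeriodicDistribution ℓ) :=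
  {h | Summable fun k : Fin n → ℤ =>
    (1 + ∑ i, (k i : ℝ) ^ 2) ^ s * ‖h.fourierCoeff k‖ ^ 2}

/-- `H^∞(T)`, the intersection of all `H^s(T)`. -/
def torusSobolevTop {n : ℕ} (ℓ : Fin n → ℝ) : Set (PeriodicDistribution ℓ) :=
  ⋂ s : ℝ, torusSobolev ℓ s

end

noncomputable section

/-! ### Fourier analysis of periodic test functions and distributions -/

section TestFunctions

variable {n : ℕ} {ℓ : Fin n → ℝ}

/-! The operators act diagonally on Fourier coefficients, so everything reduces to upper bounds for
the multiplier `m`. Since `m ≤ 0`, both factors `e^{mt}` and `m e^{mt}` are bounded for fixed `t >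
0`; the coefficients of `U` and `V` then grow at most polynomially and, by
`exists_periodicDistribution`, are those of distributions. Nothing more is needed for `β < n`.

A gain of regularity comes from a bound `m(ν) ≤ C - A log(1 + ‖ν‖)`: it turns `e^{2mt}` into a
multiple of `(1 + ‖k‖²)^{-At}`, which is a gain of `At` Sobolev orders. The extra factor `m` in `V`
costs an arbitrarily small fraction of the time `t` (`abs_mul_exp_le`).

For `β = n` the measure `‖z‖^{-n} dz` is scale invariant. Doubling `ν` therefore adds to the
integral of `(1 - cos(ν·z))‖z‖^{-n}` exactly the integral over a dyadic shell, which tends to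
`sphereArea n * log 2` by the Riemann–Lebesgue lemma. Counting doublings gives every rate `A` below
`c^{δ,n} * sphereArea n = 4n/δ²`; the epsilons pay for the strict inequality and, for `V`, for the
factor `m`.

For `n < β < n + 2` the kernel on a small ball of radius `ρ` dominates `ρ^{n-β}‖z‖^{-n}`, and
`ρ^{n-β}` is as large as desired, so every rate `A` is available. For `n + 2 ≤ β < n + 4` the
hypergeometric factor is at least 1 (`one_le_hyp2F3`), whence `m(ν) ≤ -‖ν‖²`. -/

theorem contDiff_torusTest (φ : TorusTestFunction ℓ) :
    ContDiff ℝ ∞ (φ : (Fin n → ℝ) → ℂ) := φ.2.1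

theorem differentiable_torusTest (φ : TorusTestFunction ℓ) :
    Differentiable ℝ (φ : (Fin n → ℝ) → ℂ) := (contDiff_torusTest φ).differentiable (by simp)

/-- The partial derivative in the `i`-th variable on periodic test functions. -/
def partialDeriv (i : Fin n) : TorusTestFunction ℓ →ₗ[ℂ] TorusTestFunction ℓ where
  toFun φ := ⟨fun x => fderiv ℝ (φ : (Fin n → ℝ) → ℂ) x (Pi.single i 1), by
    refine ⟨?_, fun j x => ?_⟩
    · exact ((contDiff_torusTest φ).fderiv_right (m := ∞) (by simp)).clm_apply contDiff_const
    · have h : (fun y => (φ : (Fin n → ℝ) → ℂ) (y + Pi.single j (ℓ j))) = φ :=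
        funext fun y => φ.2.2 j y
      have h2 := fderiv_comp_add_right (𝕜 := ℝ) (f := (φ : (Fin n → ℝ) → ℂ)) (x := x)
        (Pi.single j (ℓ j))
      rw [h] at h2
      simp only [h2]⟩
  map_add' φ ψ := by
    ext x
    simp [fderiv_add ((differentiable_torusTest φ) x) ((differentiable_torusTest ψ) x)]
  map_smul' c φ := by
    ext x
    simp [fderiv_const_smul ((differentiable_torusTest φ) x)]

theorem partialDeriv_apply (i : Fin n) (φ : TorusTestFunction ℓ) (x : Fin n → ℝ) :
    (partialDeriv i φ : (Fin n → ℝ) → ℂ) x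
      = fderiv ℝ (φ : (Fin n → ℝ) → ℂ) x (Pi.single i 1) := rfl

/-- The integral of a partial derivative of a periodic function over a period box vanishes. -/
theorem integral_partialDeriv (hℓ : ∀ i, 0 < ℓ i) (i : Fin n) (φ : TorusTestFunction ℓ) :
    ∫ x in Set.Icc (0 : Fin n → ℝ) ℓ, (partialDeriv i φ : (Fin n → ℝ) → ℂ) x = 0 := by
  cases n with
  | zero => exact i.elim0
  | succ m =>
    -- Divergence theorem for the field `φ eᵢ`: only the two faces orthogonal to `eᵢ` contribute,
    -- and they cancel by periodicity.
    have key := MeasureTheory.integral_divergence_of_hasFDerivAt_off_countable'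
      (a := (0 : Fin (m + 1) → ℝ)) (b := ℓ) (fun i => (hℓ i).le)
      (Pi.single i (φ : (Fin (m + 1) → ℝ) → ℂ))
      (Pi.single i (fderiv ℝ (φ : (Fin (m + 1) → ℝ) → ℂ))) ∅ Set.countable_empty
      (fun j => by
        by_cases h : j = i
        · subst h; simpa using (contDiff_torusTest φ).continuous.continuousOn
        · simp only [Pi.single_eq_of_ne h]; exact continuousOn_const)
      (fun x _ j => by
        by_cases h : j = i
        · subst h; simpa using ((differentiable_torusTest φ) x).hasFDerivAt
        · simp only [Pi.single_eq_of_ne h]; exact hasFDerivAt_const (0 : ℂ) x)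
      (by
        refine ContinuousOn.integrableOn_compact isCompact_Icc (Continuous.continuousOn ?_)
        refine continuous_finsetSum _ fun j _ => ?_
        by_cases h : j = i
        · subst h
          simp only [Pi.single_eq_same]
          exact (contDiff_torusTest (partialDeriv j φ)).continuous
        · simp only [Pi.single_eq_of_ne h]; exact continuous_const)
    have h1 : ∀ x : Fin (m + 1) → ℝ, ∑ j, (Pi.single i (fderiv ℝ (φ : (Fin (m + 1) → ℝ) → ℂ)) :
        Fin (m + 1) → (Fin (m + 1) → ℝ) → (Fin (m + 1) → ℝ) →L[ℝ] ℂ) j x (Pi.single j 1)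
        = (partialDeriv i φ : (Fin (m + 1) → ℝ) → ℂ) x := by
      intro x
      rw [Finset.sum_eq_single i]
      · simp [partialDeriv_apply]
      · intro j _ h; simp [Pi.single_eq_of_ne h]
      · simp
    simp only [h1] at key
    rw [key]
    refine Finset.sum_eq_zero fun j _ => ?_
    by_cases h : j = i
    · subst h
      rw [sub_eq_zero]
      refine MeasureTheory.integral_congr_ae (Filter.Eventually.of_forall fun x => ?_)
      simp only [Pi.single_eq_same]
      refine Eq.trans ?_ (φ.2.2 j _)
      refine congrArg φ.1 (funext fun k => ?_)
      rcases Fin.eq_self_or_eq_succAbove j k with rfl | ⟨k, rfl⟩ <;> simp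
    · simp [Pi.single_eq_of_ne h]

theorem torusExpFun_add (k j : Fin n → ℤ) (x : Fin n → ℝ) :
    torusExpFun ℓ (k + j) x = torusExpFun ℓ k x * torusExpFun ℓ j x := by
  simp only [torusExpFun, ← Complex.exp_add, ← mul_add, ← Complex.ofReal_add,
    ← Finset.sum_add_distrib]
  congr 4
  ext i
  simp [torusFreq]
  ring

theorem torusExpFun_zero (x : Fin n → ℝ) : torusExpFun ℓ 0 x = 1 := by
  simp [torusExpFun, torusFreq]

theorem norm_torusExpFun (k : Fin n → ℤ) (x : Fin n → ℝ) : ‖torusExpFun ℓ k x‖ = 1 := by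
  rw [torusExpFun, mul_comm, Complex.norm_exp_ofReal_mul_I]

theorem partialDeriv_torusExp (i : Fin n) (k : Fin n → ℤ) :
    partialDeriv i (torusExp ℓ k)
      = (Complex.I * (torusFreq ℓ k i : ℝ)) • torusExp ℓ k := by
  ext x
  rw [partialDeriv_apply]
  have h0 : HasFDerivAt (fun x : Fin n → ℝ => ∑ i, torusFreq ℓ k i * x i)
      (∑ i, torusFreq ℓ k i • ContinuousLinearMap.proj (R := ℝ) (φ := fun _ : Fin n => ℝ) i) x := by
    refine HasFDerivAt.fun_sum fun j _ => ?_
    exact ((ContinuousLinearMap.proj (R := ℝ) (φ := fun _ : Fin n => ℝ) j).hasFDerivAt).const_mul _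
  have h1 := ((Complex.ofRealCLM.hasFDerivAt.comp x h0).const_mul Complex.I).cexp
  have h2 : HasFDerivAt (torusExp ℓ k : (Fin n → ℝ) → ℂ) _ x := h1
  rw [h2.fderiv]
  simp [torusExp, torusExpFun, Pi.single_apply]
  ring

/-- Products of periodic test functions. -/
def torusTestMul (φ ψ : TorusTestFunction ℓ) : TorusTestFunction ℓ :=
  ⟨fun x => (φ : (Fin n → ℝ) → ℂ) x * (ψ : (Fin n → ℝ) → ℂ) x,
    (contDiff_torusTest φ).mul (contDiff_torusTest ψ), fun i x => by
      change φ.1 _ * ψ.1 _ = _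
      rw [φ.2.2, ψ.2.2]⟩

/-- The pairing of a test function with `e^{i ν_k · x}`. -/
def expPairing (ℓ : Fin n → ℝ) (k : Fin n → ℤ) (φ : TorusTestFunction ℓ) : ℂ :=
  ∫ x in Set.Icc (0 : Fin n → ℝ) ℓ, torusExpFun ℓ k x * (φ : (Fin n → ℝ) → ℂ) x

theorem integrableOn_torusTest (φ : TorusTestFunction ℓ) :
    MeasureTheory.IntegrableOn (φ : (Fin n → ℝ) → ℂ) (Set.Icc 0 ℓ) :=
  (contDiff_torusTest φ).continuous.continuousOn.integrableOn_compact isCompact_Icc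

theorem integrableOn_torusExpFun_mul (k : Fin n → ℤ) (φ : TorusTestFunction ℓ) :
    MeasureTheory.IntegrableOn (fun x => torusExpFun ℓ k x * (φ : (Fin n → ℝ) → ℂ) x)
      (Set.Icc 0 ℓ) :=
  integrableOn_torusTest (torusTestMul (torusExp ℓ k) φ)

theorem expPairing_add (k : Fin n → ℤ) (φ ψ : TorusTestFunction ℓ) :
    expPairing ℓ k (φ + ψ) = expPairing ℓ k φ + expPairing ℓ k ψ := by
  unfold expPairing
  rw [← MeasureTheory.integral_add (integrableOn_torusExpFun_mul k φ)
    (integrableOn_torusExpFun_mul k ψ)]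
  simp [mul_add]

theorem expPairing_smul (k : Fin n → ℤ) (c : ℂ) (φ : TorusTestFunction ℓ) :
    expPairing ℓ k (c • φ) = c * expPairing ℓ k φ := by
  unfold expPairing
  rw [← MeasureTheory.integral_const_mul]
  congr 1
  ext x
  simp
  ring

theorem expPairing_partialDeriv (hℓ : ∀ i, 0 < ℓ i) (i : Fin n) (k : Fin n → ℤ)
    (φ : TorusTestFunction ℓ) :
    expPairing ℓ k (partialDeriv i φ)
      = -(Complex.I * (torusFreq ℓ k i : ℝ)) * expPairing ℓ k φ := by
  have h1 := integral_partialDeriv hℓ i (torusTestMul (torusExp ℓ k) φ)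
  have h2 : ∀ x, (partialDeriv i (torusTestMul (torusExp ℓ k) φ) : (Fin n → ℝ) → ℂ) x
      = torusExpFun ℓ k x * (partialDeriv i φ : (Fin n → ℝ) → ℂ) x
        + Complex.I * (torusFreq ℓ k i : ℝ) *
          (torusExpFun ℓ k x * (φ : (Fin n → ℝ) → ℂ) x) := by
    intro x
    have h3 := congrArg (fun ψ : TorusTestFunction ℓ => (ψ : (Fin n → ℝ) → ℂ) x)
      (partialDeriv_torusExp i k)
    simp only [partialDeriv_apply, Submodule.coe_smul, Pi.smul_apply, smul_eq_mul] at h3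
    rw [partialDeriv_apply]
    have h4 := fderiv_mul (differentiable_torusTest (torusExp ℓ k) x)
      (differentiable_torusTest φ x)
    have h5 : ((torusTestMul (torusExp ℓ k) φ : TorusTestFunction ℓ) : (Fin n → ℝ) → ℂ)
      = (torusExp ℓ k : (Fin n → ℝ) → ℂ) * φ := rfl
    rw [h5, h4]
    simp only [add_apply, smul_apply, h3, smul_eq_mul]
    simp only [partialDeriv_apply, torusExp]
    ring
  simp only [h2] at h1
  rw [MeasureTheory.integral_add (integrableOn_torusExpFun_mul k (partialDeriv i φ))
    ((integrableOn_torusExpFun_mul k φ).const_mul _), MeasureTheory.integral_const_mul] at h1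
  unfold expPairing
  linear_combination h1

/-- For `k ≠ j` the exponential of frequency `k - j` is, up to a nonzero factor, its own partial
derivative in some direction, so its integral vanishes. -/
theorem expPairing_torusExp (hℓ : ∀ i, 0 < ℓ i) (k j : Fin n → ℤ) :
    expPairing ℓ k (torusExp ℓ (-j)) = if k = j then ((∏ i, ℓ i : ℝ) : ℂ) else 0 := by
  have h0 : expPairing ℓ k (torusExp ℓ (-j))
      = ∫ x in Set.Icc (0 : Fin n → ℝ) ℓ, torusExpFun ℓ (k - j) x := by
    simp [expPairing, torusExp, sub_eq_add_neg, torusExpFun_add]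
  split_ifs with h
  · have hle : (0 : Fin n → ℝ) ≤ ℓ := fun i => (hℓ i).le
    rw [h0, h]
    simp [torusExpFun_zero, MeasureTheory.measureReal_def, Real.volume_Icc_pi_toReal hle]
  · obtain ⟨i, hi⟩ := Function.ne_iff.1 h
    have h1 := integral_partialDeriv hℓ i (torusExp ℓ (k - j))
    rw [partialDeriv_torusExp] at h1
    simp only [Submodule.coe_smul, Pi.smul_apply, smul_eq_mul,
      MeasureTheory.integral_const_mul] at h1
    rw [h0]
    refine (mul_eq_zero.1 h1).resolve_left ?_
    have : (k i : ℝ) - j i ≠ 0 := sub_ne_zero.2 (by exact_mod_cast hi)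
    simp only [torusFreq, Pi.sub_apply, Int.cast_sub, mul_eq_zero, Complex.I_ne_zero,
      Complex.ofReal_eq_zero, false_or, div_eq_zero_iff, not_or]
    exact ⟨⟨⟨two_ne_zero, Real.pi_ne_zero⟩, this⟩, (hℓ i).ne'⟩

/-- The weight `1 + ‖k‖²`. -/
def freqWeight (k : Fin n → ℤ) : ℝ := 1 + ∑ i, (k i : ℝ) ^ 2

theorem one_le_freqWeight (k : Fin n → ℤ) : 1 ≤ freqWeight k :=
  le_add_of_nonneg_right (Finset.sum_nonneg fun _ _ => sq_nonneg _)

theorem freqWeight_pos (k : Fin n → ℤ) : 0 < freqWeight k :=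
  one_pos.trans_le (one_le_freqWeight k)

/-- The operator `1 - Δ` in coordinates rescaled to the standard lattice. -/
def besselOp (ℓ : Fin n → ℝ) : TorusTestFunction ℓ →ₗ[ℂ] TorusTestFunction ℓ :=
  LinearMap.id - ∑ i, (((ℓ i / (2 * Real.pi)) ^ 2 : ℝ) : ℂ) • (partialDeriv i ∘ₗ partialDeriv i)

/-- Pairing with `e^{i ν_k · x}` as a linear functional. -/
def expPairingₗ (ℓ : Fin n → ℝ) (k : Fin n → ℤ) : TorusTestFunction ℓ →ₗ[ℂ] ℂ where
  toFun := expPairing ℓ k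
  map_add' := expPairing_add k
  map_smul' := expPairing_smul k

/-- Two integrations by parts give `-ν_{k,i}²`, and the rescaling by `(ℓᵢ/2π)²` makes this exactly
`-kᵢ²`. Iterating yields the decay of the Fourier coefficients. -/
theorem expPairing_besselOp (hℓ : ∀ i, 0 < ℓ i) (k : Fin n → ℤ) (φ : TorusTestFunction ℓ) :
    expPairing ℓ k (besselOp ℓ φ) = freqWeight k * expPairing ℓ k φ := by
  change expPairingₗ ℓ k (besselOp ℓ φ) = _
  simp only [besselOp, LinearMap.sub_apply, LinearMap.id_apply, LinearMap.sum_apply,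
    LinearMap.smul_apply, LinearMap.comp_apply, map_sub, map_sum, map_smul]
  change expPairing ℓ k φ - ∑ i, _ • expPairing ℓ k _ = _
  simp only [expPairing_partialDeriv hℓ, freqWeight, Complex.ofReal_add, Complex.ofReal_one,
    add_mul, one_mul, Complex.ofReal_sum, Finset.sum_mul, sub_eq_add_neg, ← Finset.sum_neg_distrib]
  congr 1
  refine Finset.sum_congr rfl fun i _ => ?_
  have h1 : (ℓ i / (2 * Real.pi)) * torusFreq ℓ k i = k i := by
    have := (hℓ i).ne'
    have := Real.pi_ne_zero
    simp only [torusFreq]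
    field_simp
  have h2 : ((ℓ i / (2 * Real.pi) : ℝ) : ℂ) * (torusFreq ℓ k i : ℝ) = (k i : ℝ) := by
    exact_mod_cast h1
  simp only [smul_eq_mul, Complex.ofReal_pow]
  rw [← h2]
  linear_combination (-((ℓ i / (2 * Real.pi) : ℝ) : ℂ) ^ 2 * (torusFreq ℓ k i : ℝ) ^ 2
    * expPairing ℓ k φ) * Complex.I_sq

theorem norm_iteratedFDeriv_partialDeriv_le (i : Fin n) (φ : TorusTestFunction ℓ) (j : ℕ)
    (x : Fin n → ℝ) :
    ‖iteratedFDeriv ℝ j (partialDeriv i φ : (Fin n → ℝ) → ℂ) x‖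
      ≤ ‖iteratedFDeriv ℝ (j + 1) (φ : (Fin n → ℝ) → ℂ) x‖ := by
  rw [← norm_iteratedFDeriv_fderiv]
  have h := norm_iteratedFDeriv_clm_apply_const (𝕜 := ℝ)
    (f := fderiv ℝ (φ : (Fin n → ℝ) → ℂ)) (c := Pi.single i (1 : ℝ)) (x := x) (N := ∞) (n := j)
    ((contDiff_torusTest φ).fderiv_right (m := ∞) (by simp)).contDiffAt (by exact_mod_cast le_top)
  have h1 : ‖(Pi.single i (1 : ℝ) : Fin n → ℝ)‖ = 1 := by rw [Pi.norm_single, norm_one]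
  rw [h1, one_mul] at h
  exact h

theorem norm_iteratedFDeriv_besselOp_le (ℓ : Fin n → ℝ) :
    ∃ C, 0 ≤ C ∧ ∀ (φ : TorusTestFunction ℓ) (B : ℝ) (N : ℕ),
      (∀ j ≤ N + 2, ∀ x, ‖iteratedFDeriv ℝ j (φ : (Fin n → ℝ) → ℂ) x‖ ≤ B) →
      ∀ j ≤ N, ∀ x, ‖iteratedFDeriv ℝ j (besselOp ℓ φ : (Fin n → ℝ) → ℂ) x‖ ≤ C * B := by
  refine ⟨1 + ∑ i, (ℓ i / (2 * Real.pi)) ^ 2, by positivity, fun φ B N h j hj x => ?_⟩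
  have h1 : ((besselOp ℓ φ : TorusTestFunction ℓ) : (Fin n → ℝ) → ℂ) = fun x =>
      (φ : (Fin n → ℝ) → ℂ) x + ∑ i, (((-(ℓ i / (2 * Real.pi)) ^ 2 : ℝ) : ℂ) •
        partialDeriv i (partialDeriv i φ) : TorusTestFunction ℓ).1 x := by
    ext x
    simp [besselOp, sub_eq_add_neg, LinearMap.sum_apply]
  have hc : ∀ ψ : TorusTestFunction ℓ, ContDiff ℝ j (ψ : (Fin n → ℝ) → ℂ) :=
    fun ψ => (contDiff_torusTest ψ).of_le (by exact_mod_cast le_top)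
  rw [h1]
  rw [fun_iteratedFDeriv_add (hc φ) (ContDiff.sum fun i _ => hc _),
    iteratedFDeriv_sum fun i _ => hc _]
  beta_reduce
  rw [Finset.sum_apply]
  refine (norm_add_le _ _).trans ?_
  rw [add_mul, one_mul, Finset.sum_mul]
  refine add_le_add (h j (by omega) x) ((norm_sum_le _ _).trans (Finset.sum_le_sum fun i _ => ?_))
  have h2 : (((-(ℓ i / (2 * Real.pi)) ^ 2 : ℝ) : ℂ) •
        partialDeriv i (partialDeriv i φ) : TorusTestFunction ℓ).1
      = ((-(ℓ i / (2 * Real.pi)) ^ 2 : ℝ) : ℂ) •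
        (partialDeriv i (partialDeriv i φ) : (Fin n → ℝ) → ℂ) := rfl
  rw [h2, iteratedFDeriv_const_smul_apply (hc _).contDiffAt, norm_smul, Complex.norm_real, norm_neg,
    Real.norm_of_nonneg (by positivity)]
  gcongr
  exact (norm_iteratedFDeriv_partialDeriv_le _ _ _ _).trans
    ((norm_iteratedFDeriv_partialDeriv_le _ _ _ _).trans (h _ (by omega) x))

theorem norm_expPairing_le (k : Fin n → ℤ) (φ : TorusTestFunction ℓ) (B : ℝ)
    (h : ∀ x, ‖(φ : (Fin n → ℝ) → ℂ) x‖ ≤ B) :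
    ‖expPairing ℓ k φ‖ ≤ MeasureTheory.volume.real (Set.Icc 0 ℓ) * B := by
  rw [mul_comm]
  refine MeasureTheory.norm_setIntegral_le_of_norm_le_const isCompact_Icc.measure_lt_top
    fun x _ => ?_
  rw [norm_mul, norm_torusExpFun, one_mul]
  exact h x

/-- Rapid decay of the Fourier coefficients of a test function. -/
theorem freqWeight_pow_mul_norm_expPairing_le (hℓ : ∀ i, 0 < ℓ i) (M : ℕ) :
    ∃ C, 0 ≤ C ∧ ∀ (φ : TorusTestFunction ℓ) (B : ℝ),
      (∀ j ≤ 2 * M, ∀ x, ‖iteratedFDeriv ℝ j (φ : (Fin n → ℝ) → ℂ) x‖ ≤ B) →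
      ∀ k, freqWeight k ^ M * ‖expPairing ℓ k φ‖ ≤ C * B := by
  induction M with
  | zero =>
    refine ⟨MeasureTheory.volume.real (Set.Icc 0 ℓ), by positivity, fun φ B h k => ?_⟩
    simpa using norm_expPairing_le k φ B fun x => by simpa using h 0 le_rfl x
  | succ M ih =>
    obtain ⟨C, hC, h⟩ := ih
    obtain ⟨C', hC', h'⟩ := norm_iteratedFDeriv_besselOp_le ℓ
    refine ⟨C * C', by positivity, fun φ B hφ k => ?_⟩
    -- Each extra power of the weight costs one application of `besselOp`, that is, two derivatives
    -- of `φ`.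
    have := h (besselOp ℓ φ) (C' * B) (h' φ B (2 * M) hφ) k
    rw [expPairing_besselOp hℓ, norm_mul, Complex.norm_real,
      Real.norm_of_nonneg (freqWeight_pos k).le] at this
    calc _ = freqWeight k ^ M * (freqWeight k * ‖expPairing ℓ k φ‖) := by ring
      _ ≤ _ := this
      _ = _ := by ring

/-- The bound `∏ (1 + kᵢ²) ≤ freqWeight k ^ n` reduces the sum to a product of `n` convergent
one-dimensional sums. -/
theorem summable_freqWeight_inv_pow : Summable fun k : Fin n → ℤ => (freqWeight k ^ n)⁻¹ := by
  have h1 : Summable fun m : ℤ => (1 + (m : ℝ) ^ 2)⁻¹ := by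
    refine Summable.of_norm_bounded_eventually (Real.summable_one_div_int_pow.2 one_lt_two) ?_
    filter_upwards [(Set.finite_singleton (0 : ℤ)).compl_mem_cofinite] with m hm
    have hm : (m : ℝ) ≠ 0 := by exact_mod_cast hm
    rw [Real.norm_of_nonneg (by positivity), one_div]
    gcongr
    linarith
  refine summable_of_sum_le (c := ∏ _i : Fin n, ∑' m : ℤ, (1 + (m : ℝ) ^ 2)⁻¹)
    (fun k => by have := freqWeight_pos k; positivity) fun s => ?_
  calc ∑ k ∈ s, (freqWeight k ^ n)⁻¹
      ≤ ∑ k ∈ s, ∏ i, (1 + (k i : ℝ) ^ 2)⁻¹ := by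
        refine Finset.sum_le_sum fun k _ => ?_
        rw [Finset.prod_inv_distrib]
        refine inv_anti₀ (Finset.prod_pos fun i _ => by positivity) ?_
        calc ∏ i, (1 + (k i : ℝ) ^ 2) ≤ ∏ _i : Fin n, freqWeight k := by
              refine Finset.prod_le_prod (fun i _ => by positivity) fun i _ => ?_
              unfold freqWeight
              gcongr
              exact Finset.single_le_sum (f := fun i => (k i : ℝ) ^ 2)
                (fun _ _ => sq_nonneg _) (Finset.mem_univ i)
          _ = _ := by simp
    -- Enlarging the finite set to the box spanned by its coordinate projections lets the sum
    -- factor.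
    _ ≤ ∑ k ∈ Fintype.piFinset (fun i => s.image fun k : Fin n → ℤ => k i),
        ∏ i, (1 + (k i : ℝ) ^ 2)⁻¹ := by
        refine Finset.sum_le_sum_of_subset_of_nonneg (fun k hk => ?_)
          fun k' _ _ => Finset.prod_nonneg (f := fun i => (1 + (k' i : ℝ) ^ 2)⁻¹)
            fun _ _ => by positivity
        exact Fintype.mem_piFinset.2 fun i => Finset.mem_image_of_mem _ hk
    _ = ∏ i, ∑ m ∈ s.image (fun k : Fin n → ℤ => k i), (1 + (m : ℝ) ^ 2)⁻¹ :=
        (Finset.prod_univ_sum (fun i => s.image fun k : Fin n → ℤ => k i)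
          (fun _ m => (1 + (m : ℝ) ^ 2)⁻¹)).symm
    _ ≤ _ := by
        refine Finset.prod_le_prod (fun _ _ => Finset.sum_nonneg fun _ _ => by positivity)
          fun i _ => h1.sum_le_tsum _ fun _ _ => by positivity

theorem apply_add_sum_single_of_periodic {E : Type*} {g : (Fin n → ℝ) → E}
    (hg : ∀ i x, g (x + Pi.single i (ℓ i)) = g x) (m : Fin n → ℤ) (x : Fin n → ℝ) :
    g (x + fun i => m i * ℓ i) = g x := by
  have key : ∀ s : Finset (Fin n), g (x + ∑ i ∈ s, m i • Pi.single i (ℓ i)) = g x := by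
    intro s
    induction s using Finset.induction_on with
    | empty => simp
    | insert i s hi ih =>
      have hp : Function.Periodic g (Pi.single i (ℓ i)) := hg i
      rw [Finset.sum_insert hi, add_comm (m i • _), ← add_assoc, hp.zsmul (m i), ih]
  rw [← key Finset.univ]
  congr 2
  ext j
  simp [Finset.sum_apply, Pi.single_apply]

/-- The derivatives of a periodic test function are bounded. -/
theorem exists_iteratedFDeriv_bound (hℓ : ∀ i, 0 < ℓ i) (φ : TorusTestFunction ℓ) (N : ℕ) :
    ∃ B, ∀ j ≤ N, ∀ x, ‖iteratedFDeriv ℝ j (φ : (Fin n → ℝ) → ℂ) x‖ ≤ B := by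
  have h1 : ∀ j, ∃ B, ∀ x, ‖iteratedFDeriv ℝ j (φ : (Fin n → ℝ) → ℂ) x‖ ≤ B := by
    intro j
    have hc : Continuous (iteratedFDeriv ℝ j (φ : (Fin n → ℝ) → ℂ)) :=
      (contDiff_torusTest φ).continuous_iteratedFDeriv (by exact_mod_cast le_top)
    obtain ⟨B, hB⟩ := (isCompact_Icc (a := (0 : Fin n → ℝ)) (b := ℓ)).exists_bound_of_continuousOn
      hc.continuousOn
    refine ⟨B, fun x => ?_⟩
    have hper : ∀ i x, iteratedFDeriv ℝ j (φ : (Fin n → ℝ) → ℂ) (x + Pi.single i (ℓ i))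
        = iteratedFDeriv ℝ j (φ : (Fin n → ℝ) → ℂ) x := by
      intro i x
      rw [← iteratedFDeriv_comp_add_right]
      congr 1
      exact funext (φ.2.2 i)
    -- Translation by whole periods brings `x` into the compact period box.
    rw [← apply_add_sum_single_of_periodic hper (fun i => -⌊x i / ℓ i⌋) x]
    refine hB _ ⟨fun i => ?_, fun i => ?_⟩
    · have h2 := (le_div_iff₀ (hℓ i)).1 (Int.floor_le (x i / ℓ i))
      simp only [Pi.zero_apply, Pi.add_apply, Int.cast_neg]
      linarith
    · have h2 := (div_lt_iff₀ (hℓ i)).1 (Int.lt_floor_add_one (x i / ℓ i))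
      simp only [Pi.add_apply, Int.cast_neg]
      linarith
  choose B hB using h1
  refine ⟨∑ j ∈ Finset.range (N + 1), B j, fun j hj x => (hB j x).trans ?_⟩
  exact Finset.single_le_sum (f := B) (fun i _ => (norm_nonneg _).trans (hB i x))
    (Finset.mem_range.2 (by omega))

/-- A family of polynomially bounded coefficients is the family of Fourier coefficients of a
periodic distribution, which is the sum of its Fourier series. -/
theorem exists_periodicDistribution (hℓ : ∀ i, 0 < ℓ i) (c : (Fin n → ℤ) → ℂ) (A : ℝ) (N : ℕ)
    (hc : ∀ k, ‖c k‖ ≤ A * freqWeight k ^ N) :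
    ∃ h : PeriodicDistribution ℓ, h.HasFourierSeries c ∧ ∀ k, h.fourierCoeff k = c k := by
  -- Of the `N + n` powers of decay, `N` absorb the growth of `c` and `n` make the series converge.
  obtain ⟨C, hC, hdecay⟩ := freqWeight_pow_mul_norm_expPairing_le hℓ (N + n)
  have hA : 0 ≤ A := by
    have h1 := (norm_nonneg _).trans (hc 0)
    simpa [freqWeight] using h1
  have hterm : ∀ (φ : TorusTestFunction ℓ) (B : ℝ),
      (∀ j ≤ 2 * (N + n), ∀ x, ‖iteratedFDeriv ℝ j (φ : (Fin n → ℝ) → ℂ) x‖ ≤ B) →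
      ∀ k, ‖c k * expPairing ℓ k φ‖ ≤ (A * C * B) * (freqWeight k ^ n)⁻¹ := by
    intro φ B hB k
    have hw := freqWeight_pos k
    rw [norm_mul, ← div_eq_mul_inv, le_div_iff₀ (by positivity)]
    calc ‖c k‖ * ‖expPairing ℓ k φ‖ * freqWeight k ^ n
        ≤ (A * freqWeight k ^ N) * ‖expPairing ℓ k φ‖ * freqWeight k ^ n := by
          gcongr; exact hc k
      _ = A * (freqWeight k ^ (N + n) * ‖expPairing ℓ k φ‖) := by ring
      _ ≤ A * (C * B) := mul_le_mul_of_nonneg_left (hdecay φ B hB k) hA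
      _ = _ := by ring
  have hsum : ∀ φ : TorusTestFunction ℓ, Summable fun k => c k * expPairing ℓ k φ := by
    intro φ
    obtain ⟨B, hB⟩ := exists_iteratedFDeriv_bound hℓ φ (2 * (N + n))
    exact Summable.of_norm_bounded (summable_freqWeight_inv_pow.mul_left _) (hterm φ B hB)
  let h : PeriodicDistribution ℓ :=
    { toLinearMap :=
        { toFun := fun φ => ∑' k, c k * expPairing ℓ k φ
          map_add' := fun φ ψ => by
            rw [← (hsum φ).tsum_add (hsum ψ)]
            simp [expPairing_add, mul_add]
          map_smul' := fun a φ => by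
            simp only [expPairing_smul, RingHom.id_apply, smul_eq_mul]
            rw [← tsum_mul_left]
            congr 1
            ext k
            ring }
      continuous' := by
        refine ⟨2 * (N + n), A * C * ∑' k : Fin n → ℤ, (freqWeight k ^ n)⁻¹, fun φ B hB => ?_⟩
        have h1 := tsum_of_norm_bounded (summable_freqWeight_inv_pow.mul_left (A * C * B)).hasSum
          (hterm φ B hB)
        rw [tsum_mul_left] at h1
        refine h1.trans (le_of_eq ?_)
        ring }
  have hser : h.HasFourierSeries c := fun φ => (hsum φ).hasSum
  refine ⟨h, hser, fun k => ?_⟩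
  have h1 : h.toLinearMap (torusExp ℓ (-k)) = c k * ((∏ i, ℓ i : ℝ) : ℂ) := by
    refine (hser (torusExp ℓ (-k))).unique ?_
    have h2 := hasSum_ite_eq k (c k * ((∏ i, ℓ i : ℝ) : ℂ))
    convert h2 using 2 with j
    change c j * expPairing ℓ j (torusExp ℓ (-k)) = _
    rw [expPairing_torusExp hℓ]
    split_ifs with hj <;> simp [hj]
  have h3 : ((∏ i, ℓ i : ℝ) : ℂ) ≠ 0 := by
    exact_mod_cast (Finset.prod_pos fun i _ => hℓ i).ne'
  rw [PeriodicDistribution.fourierCoeff, h1]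
  field_simp

end TestFunctions

end

noncomputable section

/-! ### The hypergeometric multiplier for `β ≥ n + 2` -/

section Hypergeometric

/-- The exponential generating function `∑ c_j x^j / j!`. -/
def expSeries (c : ℕ → ℝ) (x : ℝ) : ℝ := ∑' j, c j * (x ^ j / (j.factorial : ℝ))

theorem summable_expSeries {c : ℕ → ℝ} {A : ℝ} (hc : ∀ j, |c j| ≤ A) (x : ℝ) :
    Summable fun j => c j * (x ^ j / (j.factorial : ℝ)) := by
  refine Summable.of_norm_bounded ((Real.summable_pow_div_factorial |x|).mul_left A) fun j => ?_
  rw [Real.norm_eq_abs, abs_mul, abs_div, abs_pow, Nat.abs_cast]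
  gcongr
  exact hc j

theorem expSeries_zero (c : ℕ → ℝ) : expSeries c 0 = c 0 := by
  rw [expSeries, tsum_eq_single 0]
  · simp
  · intro j hj; simp [hj]

/-- For exponential generating functions, differentiation is the shift of coefficients, so bounded
coefficients stay bounded and derivatives can be iterated. -/
theorem hasDerivAt_expSeries {c : ℕ → ℝ} {A : ℝ} (hc : ∀ j, |c j| ≤ A) (x : ℝ) :
    HasDerivAt (expSeries c) (expSeries (fun j => c (j + 1)) x) x := by
  have hA : 0 ≤ A := (abs_nonneg _).trans (hc 0)
  set R := |x| + 1 with hR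
  have hterm : ∀ j : ℕ, ∀ y : ℝ,
      c (j + 1) * (((j + 1 : ℕ) : ℝ) * y ^ j / ((j + 1).factorial : ℝ))
        = c (j + 1) * (y ^ j / (j.factorial : ℝ)) := by
    intro j y
    have h1 : (j.factorial : ℝ) ≠ 0 := by positivity
    rw [Nat.factorial_succ]
    push_cast
    field_simp
  have key := hasDerivAt_tsum_of_isPreconnected (𝕜 := ℝ) (F := ℝ) (t := Set.Ioo (-R) R)
    (g := fun (j : ℕ) y => c j * (y ^ j / (j.factorial : ℝ)))
    (g' := fun (j : ℕ) y => c j * ((j : ℝ) * y ^ (j - 1) / (j.factorial : ℝ)))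
    (u := fun (j : ℕ) => A * ((j : ℝ) * R ^ (j - 1) / (j.factorial : ℝ))) (y₀ := 0) (y := x)
    (by
      rw [← summable_nat_add_iff 1]
      refine ((Real.summable_pow_div_factorial R).mul_left A).congr fun j => ?_
      have h1 : (j.factorial : ℝ) ≠ 0 := by positivity
      simp only [Nat.factorial_succ, Nat.add_sub_cancel]
      push_cast
      field_simp)
    isOpen_Ioo isPreconnected_Ioo
    (fun j y _ => ((hasDerivAt_pow j y).div_const _).const_mul _)
    (fun j y hy => by
      have h1 : |y| ≤ R := abs_le.2 ⟨hy.1.le, hy.2.le⟩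
      rw [Real.norm_eq_abs, abs_mul, abs_div, abs_mul, abs_pow, Nat.abs_cast, Nat.abs_cast]
      gcongr
      exact hc j)
    (by constructor <;> simp only [hR] <;> linarith [abs_nonneg x])
    (summable_expSeries hc 0)
    (by constructor <;> simp only [hR] <;> linarith [neg_abs_le x, le_abs_self x])
  refine HasDerivAt.congr_deriv key ?_
  have hs : Summable fun j : ℕ => c j * ((j : ℝ) * x ^ (j - 1) / (j.factorial : ℝ)) := by
    rw [← summable_nat_add_iff 1]
    refine (summable_expSeries (c := fun j => c (j + 1)) (fun j => hc _) x).congr fun j => ?_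
    rw [Nat.add_sub_cancel, hterm]
  rw [hs.tsum_eq_zero_add, expSeries]
  simp only [Nat.add_sub_cancel, hterm]
  simp

theorem hasSum_expSeries {c : ℕ → ℝ} {A : ℝ} (hc : ∀ j, |c j| ≤ A) (x : ℝ) :
    HasSum (fun j => c j * (x ^ j / (j.factorial : ℝ))) (expSeries c x) :=
  (summable_expSeries hc x).hasSum

/-- The factor `j` on coefficients is the Euler operator `x d/dx`; this turns coefficient
recurrences into differential equations. -/
theorem hasSum_mul_expSeries_succ {c : ℕ → ℝ} {A : ℝ} (hc : ∀ j, |c j| ≤ A) (x : ℝ) :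
    HasSum (fun j : ℕ => (j : ℝ) * c j * (x ^ j / (j.factorial : ℝ)))
      (x * expSeries (fun j => c (j + 1)) x) := by
  rw [← hasSum_nat_add_iff' 1]
  simp only [Finset.range_one, Finset.sum_singleton, Nat.cast_zero, zero_mul, sub_zero]
  refine ((hasSum_expSeries (fun j => hc (j + 1)) x).mul_left x).congr_fun fun j => ?_
  have h1 : (j.factorial : ℝ) ≠ 0 := by positivity
  rw [Nat.factorial_succ]
  push_cast
  field_simp
  ring

/-- The coefficients of the confluent limit function `₀F₁(; b; -x)`. -/
def besselCoeff (b : ℝ) (j : ℕ) : ℝ := (-1) ^ j / (ascPochhammer ℝ j).eval b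

variable {b : ℝ}

theorem one_le_ascPochhammer_eval (hb : 1 ≤ b) (j : ℕ) : 1 ≤ (ascPochhammer ℝ j).eval b := by
  induction j with
  | zero => simp
  | succ j ih =>
    rw [ascPochhammer_succ_eval]
    have : (0 : ℝ) ≤ j := j.cast_nonneg
    nlinarith

theorem abs_besselCoeff_le (hb : 1 ≤ b) (j : ℕ) : |besselCoeff b j| ≤ 1 := by
  have h := one_le_ascPochhammer_eval hb j
  rw [besselCoeff, abs_div, abs_pow, abs_neg, abs_one, one_pow, abs_of_pos (by linarith)]
  exact div_le_one_of_le₀ h (by linarith)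

theorem besselCoeff_succ (hb : 1 ≤ b) (j : ℕ) :
    (b + j) * besselCoeff b (j + 1) = -besselCoeff b j := by
  have h := one_le_ascPochhammer_eval hb j
  have h2 : (ascPochhammer ℝ j).eval b ≠ 0 := by linarith
  have h3 : b + j ≠ 0 := by positivity
  rw [besselCoeff, besselCoeff, ascPochhammer_succ_eval]
  field_simp
  ring

theorem expSeries_besselCoeff_ode (hb : 1 ≤ b) (x : ℝ) :
    x * expSeries (fun j => besselCoeff b (j + 2)) x
      + b * expSeries (fun j => besselCoeff b (j + 1)) x + expSeries (besselCoeff b) x = 0 := by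
  have h1 := hasSum_mul_expSeries_succ (c := fun j => besselCoeff b (j + 1))
    (fun j => abs_besselCoeff_le hb _) x
  have h2 := (hasSum_expSeries (c := fun j => besselCoeff b (j + 1))
    (fun j => abs_besselCoeff_le hb _) x).mul_left b
  have h3 := hasSum_expSeries (abs_besselCoeff_le hb) x
  refine ((h1.add h2).add h3).unique (hasSum_zero.congr_fun fun j => ?_)
  linear_combination (x ^ j / (j.factorial : ℝ)) * besselCoeff_succ hb j

/-- By the equation `x w'' + b w' + w = 0`, the energy `x w'² + w²` has derivative `(1 - 2b) w'² ≤
0` and starts at 1, so `w² ≤ 1` for `x ≥ 0`. -/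
theorem expSeries_besselCoeff_le_one (hb : 1 ≤ b) {x : ℝ} (hx : 0 ≤ x) :
    expSeries (besselCoeff b) x ≤ 1 := by
  set w := expSeries (besselCoeff b)
  set w₁ := expSeries fun j => besselCoeff b (j + 1)
  set w₂ := expSeries fun j => besselCoeff b (j + 2)
  have hd : ∀ y, HasDerivAt w (w₁ y) y := hasDerivAt_expSeries (abs_besselCoeff_le hb)
  have hd₁ : ∀ y, HasDerivAt w₁ (w₂ y) y :=
    hasDerivAt_expSeries (c := fun j => besselCoeff b (j + 1)) fun j => abs_besselCoeff_le hb _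
  have hE : ∀ y, HasDerivAt (fun y => y * w₁ y ^ 2 + w y ^ 2) ((1 - 2 * b) * w₁ y ^ 2) y := by
    intro y
    have h := ((hasDerivAt_id y).mul ((hd₁ y).pow 2)).add ((hd y).pow 2)
    refine HasDerivAt.congr_deriv h ?_
    have h0 : y * w₂ y + b * w₁ y + w y = 0 := expSeries_besselCoeff_ode hb y
    simp only [id, Pi.pow_apply, Nat.cast_ofNat]
    linear_combination (2 * w₁ y) * h0
  have hanti : Antitone fun y => y * w₁ y ^ 2 + w y ^ 2 := by
    refine antitone_of_deriv_nonpos (fun y => (hE y).differentiableAt) fun y => ?_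
    rw [(hE y).deriv]
    exact mul_nonpos_of_nonpos_of_nonneg (by linarith) (sq_nonneg _)
  have h := hanti hx
  have hw0 : w 0 = 1 := by simp [w, expSeries_zero, besselCoeff]
  simp only [hw0, zero_mul, zero_add, one_pow] at h
  have h2 : w x ^ 2 ≤ 1 := by nlinarith [sq_nonneg (w₁ x), mul_nonneg hx (sq_nonneg (w₁ x))]
  nlinarith

/-- The coefficients of `₁F₂(1; 2, b; -x)`, the mean of `₀F₁(; b; -y)` over `y ∈ [0, x]`. -/
def meanBesselCoeff (b : ℝ) (j : ℕ) : ℝ := besselCoeff b j / (j + 1)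

theorem abs_meanBesselCoeff_le (hb : 1 ≤ b) (j : ℕ) : |meanBesselCoeff b j| ≤ 1 := by
  have h : (0 : ℝ) ≤ j := j.cast_nonneg
  rw [meanBesselCoeff, abs_div, abs_of_pos (by linarith : (0 : ℝ) < j + 1)]
  exact div_le_one_of_le₀ ((abs_besselCoeff_le hb j).trans (by linarith)) (by linarith)

/-- Since `(y G)' = w` for the function `w ≤ 1` of the previous bound, `y G - y` decreases from 0.
-/
theorem expSeries_meanBesselCoeff_le_one (hb : 1 ≤ b) {x : ℝ} (hx : 0 < x) :
    expSeries (meanBesselCoeff b) x ≤ 1 := by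
  set G := expSeries (meanBesselCoeff b)
  have hG : ∀ y, HasDerivAt (fun y => y * G y - y) (expSeries (besselCoeff b) y - 1) y := by
    intro y
    have h := ((hasDerivAt_id y).mul (hasDerivAt_expSeries (abs_meanBesselCoeff_le hb) y)).sub
      (hasDerivAt_id y)
    refine HasDerivAt.congr_deriv h ?_
    have h1 := hasSum_mul_expSeries_succ (abs_meanBesselCoeff_le hb) y
    have h2 := hasSum_expSeries (abs_meanBesselCoeff_le hb) y
    have h3 : expSeries (besselCoeff b) y
        = y * expSeries (fun j => meanBesselCoeff b (j + 1)) y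
          + expSeries (meanBesselCoeff b) y := by
      refine (hasSum_expSeries (abs_besselCoeff_le hb) y).unique ((h1.add h2).congr_fun fun j => ?_)
      have h4 : (j : ℝ) + 1 ≠ 0 := by positivity
      rw [meanBesselCoeff]
      field_simp
    rw [h3]
    simp only [id]
    ring
  have hanti : AntitoneOn (fun y => y * G y - y) (Set.Ici 0) := by
    refine antitoneOn_of_deriv_nonpos (convex_Ici 0)
      (fun y _ => (hG y).continuousAt.continuousWithinAt)
      (fun y _ => (hG y).differentiableAt.differentiableWithinAt) fun y hy => ?_
    rw [interior_Ici] at hy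
    rw [(hG y).deriv]
    linarith [expSeries_besselCoeff_le_one hb (le_of_lt hy)]
  have h := hanti (Set.self_mem_Ici (a := (0 : ℝ))) hx.le hx.le
  simp only [zero_mul, sub_zero] at h
  nlinarith

/-- The value of `₂F₃(1, a; 2, b, a + 1; -x)` is at least one for `-1 < a ≤ 0` and `b ≥ 1`. -/
theorem one_le_hyp2F3 {a : ℝ} (ha : -1 < a) (ha0 : a ≤ 0) (hb : 1 ≤ b) {x : ℝ} (hx : 0 ≤ x) :
    1 ≤ hyp2F3 1 a 2 b (a + 1) (-x) := by
  -- With `G` the series of `meanBesselCoeff b`, and `Q`, `H` those of `q`, `h`: `y Q(y) = 1 -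
  -- G(y)`, and the hypergeometric value is `1 + x H(x)` because `(a)_{j+1} / (a+1)_{j+1} = a / (a +
  -- 1 + j)`. It remains to see `H ≥ 0`.
  set q : ℕ → ℝ := fun j => -meanBesselCoeff b (j + 1) / (j + 1) with hq
  set h : ℕ → ℝ := fun j => -a / (a + 1 + j) * q j with hh
  have hq1 : ∀ j, |q j| ≤ 1 := fun j => by
    have h : (0 : ℝ) ≤ j := j.cast_nonneg
    simp only [hq]
    rw [abs_div, abs_neg, abs_of_pos (by linarith : (0 : ℝ) < j + 1)]
    exact div_le_one_of_le₀ ((abs_meanBesselCoeff_le hb _).trans (by linarith)) (by linarith)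
  have hh1 : ∀ j, |h j| ≤ -a / (a + 1) := fun j => by
    have h : (0 : ℝ) ≤ j := j.cast_nonneg
    simp only [hh]
    rw [abs_mul, abs_of_nonneg (div_nonneg (by linarith) (by linarith))]
    calc -a / (a + 1 + j) * |q j| ≤ -a / (a + 1 + j) * 1 :=
          mul_le_mul_of_nonneg_left (hq1 j) (div_nonneg (by linarith) (by linarith))
      _ ≤ _ := by
        rw [mul_one]
        exact div_le_div_of_nonneg_left (by linarith) (by linarith) (by linarith)
  have hfac : ∀ j : ℕ, (j.factorial : ℝ) ≠ 0 := fun j => by positivity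
  have hF : HasSum (fun j : ℕ => ((ascPochhammer ℝ j).eval 1 * (ascPochhammer ℝ j).eval a) /
      ((ascPochhammer ℝ j).eval 2 * (ascPochhammer ℝ j).eval b *
        (ascPochhammer ℝ j).eval (a + 1)) * ((-x) ^ j / (Nat.factorial j : ℝ)))
      (1 + x * expSeries h x) := by
    rw [← hasSum_nat_add_iff' 1]
    simp only [Finset.range_one, Finset.sum_singleton, ascPochhammer_zero, Polynomial.eval_one,
      pow_zero, Nat.factorial_zero, Nat.cast_one, mul_one, div_one, add_sub_cancel_left]
    refine ((hasSum_expSeries hh1 x).mul_left x).congr_fun fun j => ?_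
    have h1 : (ascPochhammer ℝ (j + 1)).eval (1 : ℝ) = ((j + 1).factorial : ℝ) := by
      rw [ascPochhammer_eval_one]
    have h2 : ∀ m : ℕ, (ascPochhammer ℝ m).eval (2 : ℝ) = ((m + 1).factorial : ℝ) := by
      intro m
      induction m with
      | zero => simp
      | succ m ih =>
        rw [ascPochhammer_succ_eval, ih, Nat.factorial_succ (m + 1)]
        push_cast
        ring
    have h3 : (ascPochhammer ℝ (j + 1)).eval a = a * (ascPochhammer ℝ j).eval (a + 1) := by
      rw [ascPochhammer_succ_left]
      simp [Polynomial.eval_comp]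
    have h4 := ascPochhammer_succ_eval (S := ℝ) j (a + 1)
    have h5 : (ascPochhammer ℝ j).eval (a + 1) ≠ 0 := (ascPochhammer_pos j _ (by linarith)).ne'
    have h6 : a + 1 + j ≠ 0 := by
      have : (0 : ℝ) ≤ j := j.cast_nonneg
      linarith
    have h7 : (ascPochhammer ℝ (j + 1)).eval b ≠ 0 := by
      linarith [one_le_ascPochhammer_eval hb (j + 1)]
    have h8 : (j : ℝ) + 1 ≠ 0 := by positivity
    have h9 : (j : ℝ) + 1 + 1 ≠ 0 := by positivity
    rw [h1, h2, h3, h4]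
    simp only [hh, hq, meanBesselCoeff, besselCoeff, Nat.factorial_succ]
    have := hfac j
    push_cast
    field_simp
    ring
  rw [hyp2F3, hF.tsum_eq]
  suffices 0 ≤ x * expSeries h x by linarith
  rcases hx.eq_or_lt with rfl | hx
  · simp
  have hQ : ∀ y, 0 < y → 0 ≤ expSeries q y := by
    intro y hy
    have h1 : y * expSeries q y = 1 - expSeries (meanBesselCoeff b) y := by
      have h2 := (hasSum_nat_add_iff' 1).2 (hasSum_expSeries (abs_meanBesselCoeff_le hb) y)
      have h3 := ((hasSum_expSeries hq1 y).mul_left y).neg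
      have h4 := h3.unique (h2.congr_fun fun j => ?_)
      · simp [meanBesselCoeff, besselCoeff] at h4
        linarith
      · have h8 : (j : ℝ) + 1 ≠ 0 := by positivity
        have := hfac j
        simp only [hq, Nat.factorial_succ]
        push_cast
        field_simp
        ring
    have h2 := expSeries_meanBesselCoeff_le_one hb hy
    exact nonneg_of_mul_nonneg_right (by linarith) hy
  have hode : ∀ y, (a + 1) * expSeries h y + y * expSeries (fun j => h (j + 1)) y
      = -a * expSeries q y := by
    intro y
    refine (((hasSum_expSeries hh1 y).mul_left (a + 1)).add
      (hasSum_mul_expSeries_succ hh1 y)).unique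
      (((hasSum_expSeries hq1 y).mul_left (-a)).congr_fun fun j => ?_)
    have h6 : a + 1 + j ≠ 0 := by
      have : (0 : ℝ) ≤ j := j.cast_nonneg
      linarith
    simp only [hh]
    field_simp
    ring
  -- The integrating factor `y^{a+1}` solves `(a+1) H + y H' = -a Q`; it vanishes at 0 because `a >
  -- -1`, and the right side is nonnegative because `a ≤ 0`.
  have hd : ∀ y, 0 < y → HasDerivAt (fun y => y ^ (a + 1) * expSeries h y)
      (y ^ a * (-a * expSeries q y)) y := by
    intro y hy
    have h1 := (Real.hasDerivAt_rpow_const (p := a + 1) (Or.inl hy.ne')).mul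
      (hasDerivAt_expSeries hh1 y)
    refine HasDerivAt.congr_deriv h1 ?_
    rw [← hode, add_sub_cancel_right, Real.rpow_add_one hy.ne']
    ring
  have hcont : Continuous (expSeries h) :=
    continuous_iff_continuousAt.2 fun y => (hasDerivAt_expSeries hh1 y).continuousAt
  have hmono : MonotoneOn (fun y => y ^ (a + 1) * expSeries h y) (Set.Ici 0) := by
    refine monotoneOn_of_deriv_nonneg (convex_Ici 0)
      (((Real.continuous_rpow_const (by linarith)).mul hcont).continuousOn) ?_ ?_
    · intro y hy
      rw [interior_Ici] at hy
      exact (hd y hy).differentiableAt.differentiableWithinAt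
    · intro y hy
      rw [interior_Ici] at hy
      rw [(hd y hy).deriv]
      exact mul_nonneg (Real.rpow_nonneg (le_of_lt hy) _) (mul_nonneg (by linarith) (hQ y hy))
  have h1 := hmono (Set.self_mem_Ici (a := (0 : ℝ))) hx.le hx.le
  simp only [Real.zero_rpow (by linarith : a + 1 ≠ 0), zero_mul] at h1
  exact mul_nonneg hx.le (nonneg_of_mul_nonneg_right h1 (Real.rpow_pos_of_pos hx _))

/-- For `β ≥ n + 2` the multiplier is dominated by that of the Laplace operator. -/
theorem multiplier_le_neg_sq {n : ℕ} (δ β : ℝ) (hβ : (n : ℝ) + 2 ≤ β) (hβ' : β < n + 4)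
    (ν : EuclideanSpace ℝ (Fin n)) : multiplier δ β ν ≤ -‖ν‖ ^ 2 := by
  rw [multiplier, if_neg (not_lt.2 hβ)]
  have h := one_le_hyp2F3 (a := ((n : ℝ) + 2 - β) / 2) (b := ((n : ℝ) + 2) / 2)
    (x := 1 / 4 * ‖ν‖ ^ 2 * δ ^ 2) (by linarith) (by linarith)
    (by linarith [(n.cast_nonneg : (0 : ℝ) ≤ n)]) (by positivity)
  have h1 : ((n : ℝ) + 2 - β) / 2 + 1 = ((n : ℝ) + 4 - β) / 2 := by ring
  have h2 : -(1 / 4 * ‖ν‖ ^ 2 * δ ^ 2) = -(1 / 4) * ‖ν‖ ^ 2 * δ ^ 2 := by ring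
  rw [h1, h2] at h
  nlinarith [sq_nonneg ‖ν‖]

end Hypergeometric

end

noncomputable section

/-! ### Growth of the integral multiplier for `β < n + 2`, and the bounds on `m` -/

section SingularIntegral

open MeasureTheory Metric Set Filter Topology

variable {n : ℕ}

theorem one_sub_cos_nonneg (x : ℝ) : 0 ≤ 1 - Real.cos x := by linarith [Real.cos_le_one x]

theorem one_sub_cos_inner_le (ν z : EuclideanSpace ℝ (Fin n)) :
    1 - Real.cos (inner ℝ ν z) ≤ ‖ν‖ ^ 2 / 2 * ‖z‖ ^ 2 := by
  have h1 := Real.one_sub_sq_div_two_le_cos (x := inner ℝ ν z)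
  have h2 : (inner ℝ ν z) ^ 2 ≤ (‖ν‖ * ‖z‖) ^ 2 :=
    sq_le_sq' (by linarith [neg_abs_le (inner ℝ ν z), abs_real_inner_le_norm ν z])
      (real_inner_le_norm ν z)
  nlinarith

theorem integrableOn_norm_rpow_ball (hn : 1 ≤ n) {p : ℝ} (hp : -(n : ℝ) < p) {ρ : ℝ} (hρ : 0 < ρ) :
    IntegrableOn (fun z : EuclideanSpace ℝ (Fin n) => ‖z‖ ^ p) (ball 0 ρ) := by
  have : Nonempty (Fin n) := ⟨⟨0, hn⟩⟩
  rw [integrableOn_fun_norm_addHaar volume (f := fun y : ℝ => y ^ p), finrank_euclideanSpace_fin]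
  have h : IntegrableOn (fun y : ℝ => y ^ ((n : ℝ) - 1 + p)) (Ioo 0 ρ) :=
    (intervalIntegral.integrableOn_Ioo_rpow_iff hρ).2 (by linarith)
  refine h.congr_fun (fun y hy => ?_) measurableSet_Ioo
  beta_reduce
  rw [Real.rpow_add hy.1, ← Real.rpow_natCast, Nat.cast_sub hn]
  simp

theorem measurable_one_sub_cos_div (β : ℝ) (ν : EuclideanSpace ℝ (Fin n)) :
    Measurable fun z : EuclideanSpace ℝ (Fin n) => (1 - Real.cos (inner ℝ ν z)) / ‖z‖ ^ β := by
  fun_prop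

/-- The quadratic vanishing of `1 - cos` at 0 leaves the singularity `‖z‖^{2-β}`, integrable because
`2 - β > -n`. -/
theorem integrableOn_one_sub_cos_div (hn : 1 ≤ n) {β : ℝ} (hβ : β < n + 2) {ρ : ℝ} (hρ : 0 < ρ)
    (ν : EuclideanSpace ℝ (Fin n)) :
    IntegrableOn (fun z : EuclideanSpace ℝ (Fin n) => (1 - Real.cos (inner ℝ ν z)) / ‖z‖ ^ β)
      (ball 0 ρ) := by
  refine Integrable.mono' ((integrableOn_norm_rpow_ball hn (p := 2 - β) (by linarith) hρ).const_mul
    (‖ν‖ ^ 2 / 2)) (measurable_one_sub_cos_div β ν).aestronglyMeasurable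
    (Eventually.of_forall fun z => ?_)
  rw [Real.norm_of_nonneg (div_nonneg (one_sub_cos_nonneg _) (by positivity))]
  rcases eq_or_ne z 0 with rfl | hz
  · simp
    positivity
  · have hz : 0 < ‖z‖ := norm_pos_iff.2 hz
    rw [Real.rpow_sub hz, ← mul_div_assoc, Real.rpow_two]
    gcongr
    exact one_sub_cos_inner_le ν z

/-- The integral of `(1 - cos (ν·z)) / ‖z‖^β` over the ball of radius `ρ`. -/
def cosIntegral (β ρ : ℝ) (ν : EuclideanSpace ℝ (Fin n)) : ℝ :=
  ∫ z in ball (0 : EuclideanSpace ℝ (Fin n)) ρ, (1 - Real.cos (inner ℝ ν z)) / ‖z‖ ^ β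

theorem cosIntegral_nonneg (β ρ : ℝ) (ν : EuclideanSpace ℝ (Fin n)) : 0 ≤ cosIntegral β ρ ν :=
  integral_nonneg fun _ => div_nonneg (one_sub_cos_nonneg _) (by positivity)

/-- The surface area of the unit sphere. -/
def sphereArea (n : ℕ) : ℝ := n * volume.real (ball (0 : EuclideanSpace ℝ (Fin n)) 1)

theorem sphereArea_eq (hn : 1 ≤ n) :
    sphereArea n = n * (Real.pi ^ ((n : ℝ) / 2) / Real.Gamma ((n : ℝ) / 2 + 1)) := by
  have : Nonempty (Fin n) := ⟨⟨0, hn⟩⟩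
  have hG : 0 < Real.Gamma ((n : ℝ) / 2 + 1) := Real.Gamma_pos_of_pos (by positivity)
  rw [sphereArea, measureReal_def, EuclideanSpace.volume_ball]
  simp only [ENNReal.ofReal_one, one_pow, one_mul, Fintype.card_fin]
  rw [ENNReal.toReal_ofReal (by positivity), Real.sqrt_eq_rpow, ← Real.rpow_natCast,
    ← Real.rpow_mul Real.pi_pos.le, one_div_mul_eq_div]

theorem sphereArea_pos (hn : 1 ≤ n) : 0 < sphereArea n := by
  have hG : 0 < Real.Gamma ((n : ℝ) / 2 + 1) := Real.Gamma_pos_of_pos (by positivity)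
  rw [sphereArea_eq hn]
  positivity

/-- The shell `ρ ≤ ‖z‖ < 2ρ`. -/
def shell (n : ℕ) (ρ : ℝ) : Set (EuclideanSpace ℝ (Fin n)) := ball 0 (2 * ρ) \ ball 0 ρ

theorem measurableSet_shell (ρ : ℝ) : MeasurableSet (shell n ρ) :=
  measurableSet_ball.diff measurableSet_ball

theorem integrableOn_shell {ρ : ℝ} (hρ : 0 < ρ) :
    IntegrableOn (fun z : EuclideanSpace ℝ (Fin n) => (‖z‖ ^ (n : ℝ))⁻¹) (shell n ρ) := by
  refine Measure.integrableOn_of_bounded (M := (ρ ^ (n : ℝ))⁻¹) ?_ ?_ ?_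
  · exact ((measure_mono sdiff_subset).trans_lt measure_ball_lt_top).ne
  · exact (by fun_prop : Measurable fun z : EuclideanSpace ℝ (Fin n) =>
      (‖z‖ ^ (n : ℝ))⁻¹).aestronglyMeasurable
  · refine (ae_restrict_iff' (measurableSet_shell ρ)).2 (Eventually.of_forall fun z hz => ?_)
    have hz : ρ ≤ ‖z‖ := by simpa using hz.2
    rw [Real.norm_of_nonneg (by positivity)]
    gcongr

/-- In polar coordinates this is the area of the sphere times `∫ dr/r` over `[ρ, 2ρ]`, hence
independent of `ρ`. -/
theorem integral_shell (hn : 1 ≤ n) {ρ : ℝ} (hρ : 0 < ρ) :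
    ∫ z in shell n ρ, (‖z‖ ^ (n : ℝ))⁻¹ = sphereArea n * Real.log 2 := by
  have : Nonempty (Fin n) := ⟨⟨0, hn⟩⟩
  have h := integral_fun_norm_addHaar (volume : Measure (EuclideanSpace ℝ (Fin n)))
    ((Ico ρ (2 * ρ)).indicator fun y : ℝ => (y ^ (n : ℝ))⁻¹)
  have h1 : ∀ z : EuclideanSpace ℝ (Fin n),
      (Ico ρ (2 * ρ)).indicator (fun y : ℝ => (y ^ (n : ℝ))⁻¹) ‖z‖
        = (shell n ρ).indicator (fun z => (‖z‖ ^ (n : ℝ))⁻¹) z := by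
    intro z
    simp only [indicator, shell, Set.mem_sdiff, mem_ball_zero_iff, mem_Ico, not_lt, and_comm]
  have h2 : ∀ y ∈ Ioi (0 : ℝ), y ^ (n - 1) • (Ico ρ (2 * ρ)).indicator
      (fun y : ℝ => (y ^ (n : ℝ))⁻¹) y = (Ico ρ (2 * ρ)).indicator (fun y : ℝ => y⁻¹) y := by
    intro y hy
    have hy : 0 < y := hy
    by_cases hm : y ∈ Ico ρ (2 * ρ)
    · obtain ⟨m, rfl⟩ : ∃ m, n = m + 1 := ⟨n - 1, by omega⟩
      simp only [indicator_of_mem hm, smul_eq_mul, Nat.add_sub_cancel, Real.rpow_natCast]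
      rw [pow_succ]
      field_simp
    · simp [indicator_of_notMem hm]
  simp only [h1] at h
  rw [integral_indicator (measurableSet_shell ρ)] at h
  rw [h, finrank_euclideanSpace_fin, setIntegral_congr_fun measurableSet_Ioi h2,
    setIntegral_indicator measurableSet_Ico,
    inter_eq_right.2 (show Ico ρ (2 * ρ) ⊆ Ioi 0 from fun y hy => hρ.trans_le hy.1),
    integral_Ico_eq_integral_Ioo, ← integral_Ioc_eq_integral_Ioo,
    ← intervalIntegral.integral_of_le (by linarith), integral_inv_of_pos hρ (by linarith),
    mul_div_assoc, div_self hρ.ne']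
  simp [sphereArea, nsmul_eq_mul, mul_assoc]

theorem tendsto_integral_cos_shell {ρ : ℝ} (hρ : 0 < ρ) :
    Tendsto (fun ν : EuclideanSpace ℝ (Fin n) =>
      ∫ z in shell n ρ, Real.cos (inner ℝ ν z) * (‖z‖ ^ (n : ℝ))⁻¹)
      (cocompact (EuclideanSpace ℝ (Fin n))) (𝓝 0) := by
  set f : EuclideanSpace ℝ (Fin n) → ℂ :=
    (shell n ρ).indicator fun z => (((‖z‖ ^ (n : ℝ))⁻¹ : ℝ) : ℂ) with hf
  have hfi : Integrable f :=
    (integrable_indicator_iff (measurableSet_shell ρ)).2 (integrableOn_shell hρ).ofReal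
  have h1 := tendsto_integral_exp_inner_smul_cocompact f
  -- The Fourier character carries a factor `2π`, so the frequency is rescaled before the
  -- Riemann–Lebesgue lemma applies.
  have h2 : Tendsto (fun ν : EuclideanSpace ℝ (Fin n) => (2 * Real.pi)⁻¹ • ν)
      (cocompact (EuclideanSpace ℝ (Fin n))) (cocompact (EuclideanSpace ℝ (Fin n))) :=
    (Homeomorph.smulOfNeZero (2 * Real.pi)⁻¹ (by positivity)).isClosedEmbedding.tendsto_cocompact
  have h3 := (Complex.continuous_re.tendsto _).comp (h1.comp h2)
  rw [Complex.zero_re] at h3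
  refine h3.congr fun ν => ?_
  have h4 : Integrable fun v => Real.fourierChar (-inner ℝ v ((2 * Real.pi)⁻¹ • ν)) • f v :=
    (Real.fourierIntegral_convergent_iff _).2 hfi
  have h5 := Complex.reCLM.integral_comp_comm h4
  simp only [Function.comp_apply]
  change Complex.reCLM _ = _
  rw [← h5, ← integral_indicator (measurableSet_shell ρ)]
  congr 1
  ext z
  by_cases hz : z ∈ shell n ρ
  · have h6 : 2 * Real.pi * -((2 * Real.pi)⁻¹ * inner ℝ z ν) = -inner ℝ ν z := by
      rw [real_inner_comm]
      field_simp
    simp only [hf, indicator_of_mem hz, Circle.smul_def, Real.fourierChar_apply, inner_smul_right,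
      Complex.reCLM_apply, smul_eq_mul, Complex.re_mul_ofReal, h6, Complex.exp_ofReal_mul_I_re,
      Real.cos_neg]
  · simp [hf, indicator_of_notMem hz]

/-- The substitution `z ↦ 2z` preserves `‖z‖^{-n} dz` and trades the doubled frequency for the
doubled ball, which is the old ball plus one shell. -/
theorem cosIntegral_two_smul (hn : 1 ≤ n) {ρ : ℝ} (hρ : 0 < ρ)
    (ν : EuclideanSpace ℝ (Fin n)) :
    cosIntegral n ρ ((2 : ℝ) • ν) = cosIntegral n ρ ν
      + ∫ z in shell n ρ, (1 - Real.cos (inner ℝ ν z)) / ‖z‖ ^ (n : ℝ) := by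
  have h1 := Measure.setIntegral_comp_smul_of_pos (volume : Measure (EuclideanSpace ℝ (Fin n)))
    (fun z => (1 - Real.cos (inner ℝ ν z)) / ‖z‖ ^ (n : ℝ)) (ball 0 ρ) (two_pos (α := ℝ))
  have h2 : ∀ z : EuclideanSpace ℝ (Fin n),
      (1 - Real.cos (inner ℝ ν ((2 : ℝ) • z))) / ‖(2 : ℝ) • z‖ ^ (n : ℝ)
        = (2 ^ n)⁻¹ * ((1 - Real.cos (inner ℝ ((2 : ℝ) • ν) z)) / ‖z‖ ^ (n : ℝ)) := by
    intro z
    rw [inner_smul_right, real_inner_smul_left, norm_smul, Real.norm_of_nonneg zero_le_two,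
      Real.mul_rpow zero_le_two (norm_nonneg _), Real.rpow_natCast 2 n]
    ring
  simp only [h2] at h1
  rw [integral_const_mul, finrank_euclideanSpace_fin, smul_eq_mul, smul_ball two_ne_zero,
    smul_zero, Real.norm_of_nonneg zero_le_two] at h1
  have h3 := mul_left_cancel₀ (by positivity) h1
  have h4 : ball (0 : EuclideanSpace ℝ (Fin n)) (2 * ρ) = ball 0 ρ ∪ shell n ρ := by
    rw [shell, union_sdiff_cancel (ball_subset_ball (by linarith))]
  have h5 := integrableOn_one_sub_cos_div hn (β := n) (by linarith) (ρ := 2 * ρ) (by linarith) ν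
  rw [cosIntegral, cosIntegral, h3, h4, setIntegral_union (t := shell n ρ) disjoint_sdiff_right
    (measurableSet_shell ρ) (h5.mono_set (ball_subset_ball (by linarith)))
    (h5.mono_set sdiff_subset)]

theorem exists_le_integral_shell (hn : 1 ≤ n) {ρ : ℝ} (hρ : 0 < ρ) {A : ℝ}
    (hA : A < sphereArea n) :
    ∃ R, 1 ≤ R ∧ ∀ ν : EuclideanSpace ℝ (Fin n), R ≤ ‖ν‖ →
      A * Real.log 2 ≤ ∫ z in shell n ρ, (1 - Real.cos (inner ℝ ν z)) / ‖z‖ ^ (n : ℝ) := by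
  have hlog := Real.log_pos one_lt_two
  have h1 := (tendsto_integral_cos_shell (n := n) hρ).eventually
    (gt_mem_nhds (mul_pos (sub_pos.2 hA) hlog))
  rw [← cobounded_eq_cocompact, ← comap_norm_atTop, eventually_comap, eventually_atTop] at h1
  obtain ⟨R, hR⟩ := h1
  refine ⟨max R 1, le_max_right _ _, fun ν hν => ?_⟩
  have h2 := hR ‖ν‖ ((le_max_left _ _).trans hν) ν rfl
  have hi := integrableOn_shell (n := n) hρ
  have hi2 : IntegrableOn (fun z : EuclideanSpace ℝ (Fin n) =>
      Real.cos (inner ℝ ν z) * (‖z‖ ^ (n : ℝ))⁻¹) (shell n ρ) := by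
    refine hi.mono' ?_ (Eventually.of_forall fun z => ?_)
    · exact (by fun_prop : Measurable fun z : EuclideanSpace ℝ (Fin n) =>
        Real.cos (inner ℝ ν z) * (‖z‖ ^ (n : ℝ))⁻¹).aestronglyMeasurable
    · rw [Real.norm_eq_abs, abs_mul, abs_of_nonneg (a := (‖z‖ ^ (n : ℝ))⁻¹) (by positivity)]
      exact mul_le_of_le_one_left (by positivity) (Real.abs_cos_le_one _)
  simp only [div_eq_mul_inv, sub_mul, one_mul]
  rw [integral_sub hi hi2, integral_shell hn hρ]
  linarith

/-- The frequency can be halved `j` times while staying above `R`, and each halving accounts for a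
contribution of at least `B`. -/
theorem nat_mul_le_cosIntegral (hn : 1 ≤ n) {ρ : ℝ} (hρ : 0 < ρ) {B R : ℝ}
    (h : ∀ ν : EuclideanSpace ℝ (Fin n), R ≤ ‖ν‖ →
      B ≤ ∫ z in shell n ρ, (1 - Real.cos (inner ℝ ν z)) / ‖z‖ ^ (n : ℝ)) (hR : 0 ≤ R) (j : ℕ) :
    ∀ ν : EuclideanSpace ℝ (Fin n), 2 ^ j * R ≤ ‖ν‖ → j * B ≤ cosIntegral n ρ ν := by
  induction j with
  | zero => intro ν _; simpa using cosIntegral_nonneg _ _ _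
  | succ j ih =>
    intro ν hν
    have h1 : ν = (2 : ℝ) • ((2 : ℝ)⁻¹ • ν) := by rw [smul_smul]; norm_num
    have h2 : ‖(2 : ℝ)⁻¹ • ν‖ = ‖ν‖ / 2 := by
      rw [norm_smul, Real.norm_of_nonneg (by norm_num)]; ring
    have h3 : 2 ^ j * R ≤ ‖(2 : ℝ)⁻¹ • ν‖ := by rw [h2]; rw [pow_succ] at hν; linarith
    have h4 : R ≤ 2 ^ j * R := le_mul_of_one_le_left hR (one_le_pow₀ one_le_two)
    rw [h1, cosIntegral_two_smul hn hρ]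
    have := ih _ h3
    have := h _ (h4.trans h3)
    push_cast
    linarith

/-- Logarithmic growth of the integral with the critical exponent `n`. -/
theorem log_le_cosIntegral (hn : 1 ≤ n) {ρ : ℝ} (hρ : 0 < ρ) {A : ℝ} (hA0 : 0 ≤ A)
    (hA : A < sphereArea n) :
    ∃ C, ∀ ν : EuclideanSpace ℝ (Fin n), A * Real.log (1 + ‖ν‖) - C ≤ cosIntegral n ρ ν := by
  obtain ⟨R, hR, h⟩ := exists_le_integral_shell hn hρ hA
  -- Below `R`, `1 + ‖ν‖ ≤ 4R` makes the lower bound nonpositive; above, `2^j R ≤ ‖ν‖ < 2^{j+1} R`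
  -- gives `1 + ‖ν‖ ≤ 4R · 2^j`, and the `j` doublings supply `j A log 2`.
  refine ⟨A * Real.log (4 * R), fun ν => ?_⟩
  rcases lt_or_ge ‖ν‖ R with hν | hν
  · have h1 : Real.log (1 + ‖ν‖) ≤ Real.log (4 * R) :=
      Real.log_le_log (by positivity) (by linarith)
    have := mul_le_mul_of_nonneg_left h1 hA0
    linarith [cosIntegral_nonneg n ρ ν]
  · obtain ⟨j, hj1, hj2⟩ := exists_nat_pow_near (x := ‖ν‖ / R) ((one_le_div (by linarith)).2 hν)
      one_lt_two
    rw [le_div_iff₀ (by linarith)] at hj1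
    rw [div_lt_iff₀ (by linarith), pow_succ] at hj2
    have h1 : Real.log (1 + ‖ν‖) ≤ Real.log (4 * R * 2 ^ j) :=
      Real.log_le_log (by positivity) (by linarith)
    rw [Real.log_mul (by positivity) (by positivity), Real.log_pow] at h1
    have h2 := mul_le_mul_of_nonneg_left h1 hA0
    have h3 := nat_mul_le_cosIntegral hn hρ h (by linarith) j ν hj1
    linarith

theorem multiplier_eq_neg_cosIntegral (δ : ℝ) {β : ℝ} (hβ : β < n + 2)
    (ν : EuclideanSpace ℝ (Fin n)) :
    multiplier δ β ν = -(scalingConst n δ β * cosIntegral β δ ν) := by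
  rw [multiplier, if_pos hβ, cosIntegral, ← mul_neg, ← integral_neg]
  congr 2
  ext z
  ring

theorem scalingConst_pos {δ : ℝ} (hδ : 0 < δ) {β : ℝ} (hβ : β < n + 2) :
    0 < scalingConst n δ β := by
  have hG : 0 < Real.Gamma ((n : ℝ) / 2 + 1) := Real.Gamma_pos_of_pos (by positivity)
  have h : 0 < (n : ℝ) + 2 - β := by linarith
  rw [scalingConst]
  positivity

/-- The powers of `π` and the Gamma factors cancel; this is the source of the constant `4n/δ²` in
the critical exponents. -/
theorem scalingConst_mul_sphereArea (hn : 1 ≤ n) {δ : ℝ} (hδ : 0 < δ) :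
    scalingConst n δ n * sphereArea n = 4 * n / δ ^ 2 := by
  have hG : 0 < Real.Gamma ((n : ℝ) / 2 + 1) := Real.Gamma_pos_of_pos (by positivity)
  have hp : 0 < Real.pi ^ ((n : ℝ) / 2) := by positivity
  rw [scalingConst, sphereArea_eq hn, add_sub_cancel_left, Real.rpow_two]
  field_simp
  ring

theorem multiplier_nonpos {δ : ℝ} (hδ : 0 < δ) {β : ℝ} (hβ : β < n + 4)
    (ν : EuclideanSpace ℝ (Fin n)) : multiplier δ β ν ≤ 0 := by
  rcases lt_or_ge β (n + 2) with h | h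
  · rw [multiplier_eq_neg_cosIntegral δ h]
    exact neg_nonpos.2 (mul_nonneg (scalingConst_pos hδ h).le (cosIntegral_nonneg _ _ _))
  · exact (multiplier_le_neg_sq δ β h hβ ν).trans (neg_nonpos.2 (sq_nonneg _))

theorem multiplier_le_log_of_eq (hn : 1 ≤ n) {δ : ℝ} (hδ : 0 < δ) {A : ℝ} (hA0 : 0 ≤ A)
    (hA : A < 4 * n / δ ^ 2) :
    ∃ C, ∀ ν : EuclideanSpace ℝ (Fin n), multiplier δ n ν ≤ C - A * Real.log (1 + ‖ν‖) := by
  have hc : 0 < scalingConst n δ n := scalingConst_pos hδ (by linarith)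
  rw [← scalingConst_mul_sphereArea hn hδ, ← div_lt_iff₀' hc] at hA
  obtain ⟨C, hC⟩ := log_le_cosIntegral hn hδ (A := A / scalingConst n δ n) (by positivity) hA
  refine ⟨scalingConst n δ n * C, fun ν => ?_⟩
  rw [multiplier_eq_neg_cosIntegral δ (by linarith)]
  have h := mul_le_mul_of_nonneg_left (hC ν) hc.le
  have h2 : scalingConst n δ n * (A / scalingConst n δ n * Real.log (1 + ‖ν‖) - C)
      = A * Real.log (1 + ‖ν‖) - scalingConst n δ n * C := by
    field_simp
  linarith

/-- Discard the part outside radius `ρ`; inside, `‖z‖^{n-β} ≥ ρ^{n-β}` because `n - β ≤ 0`. -/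
theorem rpow_mul_cosIntegral_le (hn : 1 ≤ n) {β : ℝ} (hβ : (n : ℝ) ≤ β) (hβ' : β < n + 2)
    {ρ δ : ℝ} (hρ : 0 < ρ) (hρδ : ρ ≤ δ) (ν : EuclideanSpace ℝ (Fin n)) :
    ρ ^ ((n : ℝ) - β) * cosIntegral n ρ ν ≤ cosIntegral β δ ν := by
  have hi := integrableOn_one_sub_cos_div hn hβ' (hρ.trans_le hρδ) ν
  have hi2 := hi.mono_set (ball_subset_ball hρδ)
  refine le_trans ?_ (setIntegral_mono_set hi (Eventually.of_forall fun z =>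
    div_nonneg (one_sub_cos_nonneg _) (by positivity)) (ball_subset_ball hρδ).eventuallyLE)
  rw [cosIntegral, ← integral_const_mul]
  refine setIntegral_mono_on ((integrableOn_one_sub_cos_div hn (by linarith) hρ ν).const_mul _)
    hi2 measurableSet_ball fun z hz => ?_
  rcases eq_or_ne z 0 with rfl | hz0
  · simp
  · have hz0 : 0 < ‖z‖ := norm_pos_iff.2 hz0
    have h1 : ρ ^ ((n : ℝ) - β) ≤ ‖z‖ ^ ((n : ℝ) - β) :=
      Real.rpow_le_rpow_of_nonpos hz0 (mem_ball_zero_iff.1 hz).le (by linarith)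
    rw [Real.rpow_sub hz0] at h1
    calc _ ≤ ‖z‖ ^ (n : ℝ) / ‖z‖ ^ β * ((1 - Real.cos (inner ℝ ν z)) / ‖z‖ ^ (n : ℝ)) :=
          mul_le_mul_of_nonneg_right h1 (div_nonneg (one_sub_cos_nonneg _) (by positivity))
      _ = _ := by
        have : ‖z‖ ^ (n : ℝ) ≠ 0 := by positivity
        field_simp

theorem multiplier_le_log_of_gt (hn : 1 ≤ n) {δ : ℝ} (hδ : 0 < δ) {β : ℝ} (hβ : (n : ℝ) < β)
    (hβ' : β < n + 4) {A : ℝ} (hA0 : 0 ≤ A) :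
    ∃ C, ∀ ν : EuclideanSpace ℝ (Fin n), multiplier δ β ν ≤ C - A * Real.log (1 + ‖ν‖) := by
  rcases lt_or_ge β (n + 2) with hlt | hge
  · have hc := scalingConst_pos hδ hlt
    have hV := sphereArea_pos hn
    have ht : Tendsto (fun ρ : ℝ => ρ ^ ((n : ℝ) - β)) (𝓝[>] 0) atTop :=
      tendsto_rpow_neg_nhdsGT_zero (by linarith)
    obtain ⟨ρ, hρA, hρ⟩ := ((ht.eventually_gt_atTop (A / (scalingConst n δ β * sphereArea n))).and
      (Ioc_mem_nhdsGT hδ)).exists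
    have hρp : 0 < ρ ^ ((n : ℝ) - β) := Real.rpow_pos_of_pos hρ.1 _
    rw [div_lt_iff₀ (by positivity)] at hρA
    have hcρ : 0 < scalingConst n δ β * ρ ^ ((n : ℝ) - β) := by positivity
    obtain ⟨C, hC⟩ := log_le_cosIntegral hn hρ.1
      (A := A / (scalingConst n δ β * ρ ^ ((n : ℝ) - β))) (by positivity)
      (by rw [div_lt_iff₀ hcρ]; linarith)
    refine ⟨scalingConst n δ β * ρ ^ ((n : ℝ) - β) * C, fun ν => ?_⟩
    rw [multiplier_eq_neg_cosIntegral δ hlt]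
    have h1 := mul_le_mul_of_nonneg_left (hC ν) hcρ.le
    have h2 := mul_le_mul_of_nonneg_left
      (rpow_mul_cosIntegral_le hn hβ.le hlt hρ.1 hρ.2 ν) hc.le
    have h3 : scalingConst n δ β * ρ ^ ((n : ℝ) - β) *
        (A / (scalingConst n δ β * ρ ^ ((n : ℝ) - β)) * Real.log (1 + ‖ν‖) - C)
        = A * Real.log (1 + ‖ν‖) - scalingConst n δ β * ρ ^ ((n : ℝ) - β) * C := by
      field_simp
    linarith
  -- With `r = ‖ν‖`: `A log(1 + r) ≤ A r ≤ A² + r²`.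
  · refine ⟨A ^ 2, fun ν => ?_⟩
    have h0 : 0 ≤ ‖ν‖ := norm_nonneg ν
    have h1 := multiplier_le_neg_sq δ β hge hβ' ν
    have h2 := Real.log_le_sub_one_of_pos (x := 1 + ‖ν‖) (by positivity)
    have h3 := mul_le_mul_of_nonneg_left h2 hA0
    nlinarith [sq_nonneg (‖ν‖ - A)]

end SingularIntegral

end

noncomputable section

/-! ### From multiplier bounds to Sobolev regularity -/

section Semigroup

variable {n : ℕ} {ℓ : Fin n → ℝ}

theorem log_freqWeight_le (hℓ : ∀ i, 0 < ℓ i) :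
    ∃ C, ∀ k : Fin n → ℤ,
      Real.log (freqWeight k) ≤ C + 2 * Real.log (1 + ‖torusFreq ℓ k‖) := by
  have hpos : ∀ i, 0 < ℓ i / (2 * Real.pi) := fun i => div_pos (hℓ i) (by positivity)
  set L := 1 + ∑ i, ℓ i / (2 * Real.pi) with hL
  have hL1 : 1 ≤ L := le_add_of_nonneg_right (Finset.sum_nonneg fun i _ => (hpos i).le)
  refine ⟨2 * Real.log L, fun k => ?_⟩
  have h1 : freqWeight k ≤ (L * (1 + ‖torusFreq ℓ k‖)) ^ 2 := by
    have h2 : ∑ i, (k i : ℝ) ^ 2 ≤ L ^ 2 * ‖torusFreq ℓ k‖ ^ 2 := by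
      rw [EuclideanSpace.real_norm_sq_eq, Finset.mul_sum]
      refine Finset.sum_le_sum fun i _ => ?_
      have h3 : (k i : ℝ) = ℓ i / (2 * Real.pi) * torusFreq ℓ k i := by
        have := (hℓ i).ne'
        simp only [torusFreq]
        field_simp
      have h4 : ℓ i / (2 * Real.pi) ≤ L := by
        have := Finset.single_le_sum (fun i _ => (hpos i).le) (Finset.mem_univ i)
        linarith
      rw [h3, mul_pow]
      have := (hpos i).le
      gcongr
    have h5 : 0 ≤ L ^ 2 * ‖torusFreq ℓ k‖ := by positivity
    unfold freqWeight
    nlinarith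
  have h6 := Real.log_le_log (freqWeight_pos k) h1
  rw [Real.log_pow, Real.log_mul (by positivity) (by positivity)] at h6
  push_cast at h6
  linarith

/-- The rate is halved because `freqWeight` is quadratic in the frequency; squaring the exponential
later restores the factor 2. -/
theorem le_log_freqWeight (hℓ : ∀ i, 0 < ℓ i) {m : EuclideanSpace ℝ (Fin n) → ℝ} {A : ℝ}
    (hA : 0 ≤ A) (h : ∃ C, ∀ ν, m ν ≤ C - A * Real.log (1 + ‖ν‖)) :
    ∃ C, ∀ k, m (torusFreq ℓ k) ≤ C - A / 2 * Real.log (freqWeight k) := by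
  obtain ⟨C, hC⟩ := h
  obtain ⟨D, hD⟩ := log_freqWeight_le hℓ
  refine ⟨C + A / 2 * D, fun k => ?_⟩
  have := mul_le_mul_of_nonneg_left (hD k) (by positivity : 0 ≤ A / 2)
  linarith [hC (torusFreq ℓ k)]

theorem exp_sq_le_of_le_log {m : (Fin n → ℤ) → ℝ} {a C t σ : ℝ} (ht : 0 ≤ t)
    (h : ∀ k, m k ≤ C - a * Real.log (freqWeight k)) (hσ : σ ≤ 2 * a * t) (k : Fin n → ℤ) :
    Real.exp (m k * t) ^ 2 ≤ Real.exp (2 * C * t) * freqWeight k ^ (-σ) := by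
  have hlog := Real.log_nonneg (one_le_freqWeight k)
  rw [Real.rpow_def_of_pos (freqWeight_pos k), ← Real.exp_add, ← Real.exp_nat_mul]
  refine Real.exp_le_exp.2 ?_
  have h1 := mul_le_mul_of_nonneg_right (h k) ht
  have h2 := mul_le_mul_of_nonneg_right hσ hlog
  push_cast
  linarith

/-- A fraction `η` of the time absorbs the factor `m`, through `x ≤ e^x` at `x = -m η t`. -/
theorem abs_mul_exp_le {m t η : ℝ} (hm : m ≤ 0) (ht : 0 < t) (hη : 0 < η) :
    |m * Real.exp (m * t)| ≤ (η * t)⁻¹ * Real.exp (m * ((1 - η) * t)) := by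
  have hηt : 0 < η * t := mul_pos hη ht
  rw [abs_mul, abs_of_nonpos hm, Real.abs_exp, ← div_eq_inv_mul, le_div_iff₀ hηt]
  have h1 : -m * (η * t) ≤ Real.exp (-m * (η * t)) := by
    linarith [Real.add_one_le_exp (-m * (η * t))]
  calc -m * Real.exp (m * t) * (η * t) = -m * (η * t) * Real.exp (m * t) := by ring
    _ ≤ Real.exp (-m * (η * t)) * Real.exp (m * t) :=
        mul_le_mul_of_nonneg_right h1 (Real.exp_pos _).le
    _ = _ := by
        rw [← Real.exp_add]
        congr 1
        ring

theorem mem_torusSobolev_add {f U : PeriodicDistribution ℓ} {s σ : ℝ} (hf : f ∈ torusSobolev ℓ s)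
    {g : (Fin n → ℤ) → ℝ} (hU : ∀ k, U.fourierCoeff k = f.fourierCoeff k * g k) {C : ℝ}
    (hg : ∀ k, g k ^ 2 ≤ C * freqWeight k ^ (-σ)) : U ∈ torusSobolev ℓ (s + σ) := by
  refine Summable.of_nonneg_of_le (fun k => ?_) (fun k => ?_) (Summable.mul_left C hf)
  · exact mul_nonneg (Real.rpow_nonneg (freqWeight_pos k).le _) (sq_nonneg _)
  · change freqWeight k ^ (s + σ) * _ ≤ C * (freqWeight k ^ s * _)
    have hw := freqWeight_pos k
    rw [hU, norm_mul, mul_pow, Complex.norm_real, Real.norm_eq_abs, sq_abs, Real.rpow_add hw]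
    calc freqWeight k ^ s * freqWeight k ^ σ * (‖f.fourierCoeff k‖ ^ 2 * g k ^ 2)
        ≤ freqWeight k ^ s * freqWeight k ^ σ *
          (‖f.fourierCoeff k‖ ^ 2 * (C * freqWeight k ^ (-σ))) := by
          gcongr
          exact hg k
      _ = C * (freqWeight k ^ s * ‖f.fourierCoeff k‖ ^ 2) *
          (freqWeight k ^ σ * freqWeight k ^ (-σ)) := by ring
      _ = _ := by rw [← Real.rpow_add hw, add_neg_cancel, Real.rpow_zero, mul_one]

/-- Each term of a convergent nonnegative series is at most its sum; `N ≥ -s/2` compensates a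
negative Sobolev order. -/
theorem exists_norm_fourierCoeff_le {f : PeriodicDistribution ℓ} {s : ℝ}
    (hf : f ∈ torusSobolev ℓ s) :
    ∃ (A : ℝ) (N : ℕ), ∀ k, ‖f.fourierCoeff k‖ ≤ A * freqWeight k ^ N := by
  obtain ⟨N, hN⟩ := exists_nat_ge (-s / 2)
  have hs : Summable fun k => freqWeight k ^ s * ‖f.fourierCoeff k‖ ^ 2 := hf
  have hnn : ∀ k, 0 ≤ freqWeight k ^ s * ‖f.fourierCoeff k‖ ^ 2 := fun k =>
    mul_nonneg (Real.rpow_nonneg (freqWeight_pos k).le _) (sq_nonneg _)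
  set S := ∑' k, freqWeight k ^ s * ‖f.fourierCoeff k‖ ^ 2 with hS
  refine ⟨√S, N, fun k => ?_⟩
  have hw := freqWeight_pos k
  have h1 : freqWeight k ^ s * ‖f.fourierCoeff k‖ ^ 2 ≤ S := hs.le_tsum k fun j _ => hnn j
  have h2 : 1 ≤ freqWeight k ^ s * (freqWeight k ^ N) ^ 2 := by
    rw [← pow_mul, ← Real.rpow_natCast, ← Real.rpow_add hw]
    refine Real.one_le_rpow (one_le_freqWeight k) ?_
    push_cast
    linarith
  have hS0 : 0 ≤ S := (hnn k).trans h1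
  refine abs_le_of_sq_le_sq' ?_ (by positivity) |>.2
  rw [mul_pow, Real.sq_sqrt hS0]
  calc ‖f.fourierCoeff k‖ ^ 2
      ≤ ‖f.fourierCoeff k‖ ^ 2 * (freqWeight k ^ s * (freqWeight k ^ N) ^ 2) :=
        le_mul_of_one_le_right (sq_nonneg _) h2
    _ = (freqWeight k ^ s * ‖f.fourierCoeff k‖ ^ 2) * (freqWeight k ^ N) ^ 2 := by ring
    _ ≤ _ := by gcongr

/-- Smoothing of the solution operator and of its time derivative for a multiplier with
logarithmic decay of rate `2a`. -/
theorem mem_torusSobolev_of_le_log {f U V : PeriodicDistribution ℓ} {s : ℝ}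
    (hf : f ∈ torusSobolev ℓ s) {m : (Fin n → ℤ) → ℝ} (hm : ∀ k, m k ≤ 0) {t : ℝ} (ht : 0 < t)
    (hU : ∀ k, U.fourierCoeff k = f.fourierCoeff k * (Real.exp (m k * t) : ℝ))
    (hV : ∀ k, V.fourierCoeff k = f.fourierCoeff k * (m k * Real.exp (m k * t) : ℝ))
    {a C : ℝ} (h : ∀ k, m k ≤ C - a * Real.log (freqWeight k)) :
    (∀ σ ≤ 2 * a * t, U ∈ torusSobolev ℓ (s + σ)) ∧
      ∀ η, 0 < η → η ≤ 1 → ∀ σ ≤ 2 * a * ((1 - η) * t), V ∈ torusSobolev ℓ (s + σ) := by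
  refine ⟨fun σ hσ => mem_torusSobolev_add hf hU (exp_sq_le_of_le_log ht.le h hσ),
    fun η hη hη1 σ hσ => ?_⟩
  have ht' : 0 ≤ (1 - η) * t := mul_nonneg (by linarith) ht.le
  refine mem_torusSobolev_add (C := ((η * t)⁻¹) ^ 2 * Real.exp (2 * C * ((1 - η) * t))) hf hV
    fun k => ?_
  rw [← sq_abs]
  calc |m k * Real.exp (m k * t)| ^ 2
      ≤ ((η * t)⁻¹ * Real.exp (m k * ((1 - η) * t))) ^ 2 := by
        gcongr
        exact abs_mul_exp_le (hm k) ht hη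
    _ = ((η * t)⁻¹) ^ 2 * Real.exp (m k * ((1 - η) * t)) ^ 2 := mul_pow _ _ _
    _ ≤ ((η * t)⁻¹) ^ 2 * (Real.exp (2 * C * ((1 - η) * t)) * freqWeight k ^ (-σ)) :=
        mul_le_mul_of_nonneg_left (exp_sq_le_of_le_log ht' h hσ k) (sq_nonneg _)
    _ = _ := (mul_assoc _ _ _).symm

end Semigroup

end

/-! ### The smoothing theorem -/

theorem mainTheorem1 (n : ℕ) (hn : 1 ≤ n) (ℓ : Fin n → ℝ) (hℓ : ∀ i, 0 < ℓ i)
    (δ β : ℝ) (hδ : 0 < δ) (hβ : β < (n : ℝ) + 4)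
    (ε₁ ε₂ : ℝ) (hε₁ : 0 < ε₁) (hε₁₂ : ε₁ < ε₂) (hε₂ : ε₂ < 1)
    (s : ℝ) (f : PeriodicDistribution ℓ) (hf : f ∈ torusSobolev ℓ s)
    (t : ℝ) (ht : 0 < t) :
    ∃ U V : PeriodicDistribution ℓ,
      U.HasFourierSeries (fun k =>
        f.fourierCoeff k * (Real.exp (multiplier δ β (torusFreq ℓ k) * t) : ℂ)) ∧
      V.HasFourierSeries (fun k =>
        f.fourierCoeff k * (multiplier δ β (torusFreq ℓ k) : ℂ) *
          (Real.exp (multiplier δ β (torusFreq ℓ k) * t) : ℂ)) ∧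
      PeriodicDistribution.IsNonlocalLaplacian δ β U V ∧
      (β < n → U ∈ torusSobolev ℓ s ∧ V ∈ torusSobolev ℓ s) ∧
      (β = n →
        U ∈ torusSobolev ℓ (s + 4 * n * t / δ ^ 2 * (1 - ε₁)) ∧
        V ∈ torusSobolev ℓ (s + 4 * n * t / δ ^ 2 * (1 - ε₂))) ∧
      (n < β → U ∈ torusSobolevTop ℓ ∧ V ∈ torusSobolevTop ℓ) := by
  set m : (Fin n → ℤ) → ℝ := fun k => multiplier δ β (torusFreq ℓ k) with hm_def
  have hm : ∀ k, m k ≤ 0 := fun k => multiplier_nonpos hδ hβ _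
  obtain ⟨A, N, hA⟩ := exists_norm_fourierCoeff_le hf
  obtain ⟨U, hU, hUc⟩ := exists_periodicDistribution hℓ
    (fun k => f.fourierCoeff k * (Real.exp (m k * t) : ℝ)) A N fun k => by
      rw [norm_mul, Complex.norm_real, Real.norm_of_nonneg (Real.exp_pos _).le]
      refine (mul_le_of_le_one_right (norm_nonneg _) ?_).trans (hA k)
      exact Real.exp_le_one_iff.2 (mul_nonpos_of_nonpos_of_nonneg (hm k) ht.le)
  obtain ⟨V, hV, hVc⟩ := exists_periodicDistribution hℓ
    (fun k => f.fourierCoeff k * (m k * Real.exp (m k * t) : ℝ)) (A * t⁻¹) N fun k => by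
      -- Taking `η = 1` spends all the time and gives the uniform bound `|m e^{mt}| ≤ 1/t`.
      have h1 := abs_mul_exp_le (hm k) ht one_pos
      rw [sub_self, zero_mul, mul_zero, Real.exp_zero, mul_one, one_mul] at h1
      rw [norm_mul, Complex.norm_real, Real.norm_eq_abs, mul_right_comm]
      exact mul_le_mul (hA k) h1 (abs_nonneg _) ((norm_nonneg _).trans (hA k))
  refine ⟨U, V, hU, ?_, ?_, fun hlt => ?_, fun heq => ?_, fun hgt => ?_⟩
  · convert hV using 2 with k
    push_cast
    ring
  · unfold PeriodicDistribution.IsNonlocalLaplacian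
    convert hV using 2 with k
    rw [hUc]
    simp only [hm_def]
    push_cast
    ring
  · obtain ⟨h1, h2⟩ := mem_torusSobolev_of_le_log hf hm ht hUc hVc (a := 0) (C := 0)
      (fun k => by simpa using hm k)
    have h3 := h1 0 (by simp)
    have h4 := h2 1 one_pos le_rfl 0 (by simp)
    rw [add_zero] at h3 h4
    exact ⟨h3, h4⟩
  · subst heq
    have hn0 : (0 : ℝ) < n := by exact_mod_cast hn
    have hK : 0 < 4 * (n : ℝ) / δ ^ 2 := by positivity
    have key : ∀ η, 0 < η → η ≤ 1 → ∃ C, ∀ k,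
        m k ≤ C - 4 * (n : ℝ) / δ ^ 2 * (1 - η) / 2 * Real.log (freqWeight k) := by
      intro η hη hη1
      have h0 : 0 ≤ 4 * (n : ℝ) / δ ^ 2 * (1 - η) := mul_nonneg hK.le (by linarith)
      exact le_log_freqWeight hℓ h0 (multiplier_le_log_of_eq hn hδ h0
        (mul_lt_of_lt_one_right hK (by linarith)))
    constructor
    · obtain ⟨C, hC⟩ := key ε₁ hε₁ (by linarith)
      exact (mem_torusSobolev_of_le_log hf hm ht hUc hVc hC).1 _ (le_of_eq (by ring))
    -- The loss is split evenly between the rate and the time absorbing `m`: `(1 - ε₂/2)² = 1 - ε₂ +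
    -- (ε₂/2)² ≥ 1 - ε₂`.
    · obtain ⟨C, hC⟩ := key (ε₂ / 2) (by linarith) (by linarith)
      refine (mem_torusSobolev_of_le_log hf hm ht hUc hVc hC).2 (ε₂ / 2) (by linarith)
        (by linarith) _ ?_
      have h1 : 0 ≤ 4 * (n : ℝ) / δ ^ 2 * t * (ε₂ / 2) ^ 2 := by positivity
      linarith [show 2 * (4 * (n : ℝ) / δ ^ 2 * (1 - ε₂ / 2) / 2) * ((1 - ε₂ / 2) * t)
        = 4 * n * t / δ ^ 2 * (1 - ε₂) + 4 * (n : ℝ) / δ ^ 2 * t * (ε₂ / 2) ^ 2 by ring]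
  · have key : ∀ r, U ∈ torusSobolev ℓ r ∧ V ∈ torusSobolev ℓ r := by
      intro r
      -- This rate gains `2|r - s|` orders for `U`, and still `|r - s|` for `V` when half the time
      -- is spent on the factor `m`.
      have h0 : 0 ≤ 2 * |r - s| / t := by positivity
      obtain ⟨C, hC⟩ := le_log_freqWeight hℓ h0 (multiplier_le_log_of_gt hn hδ hgt hβ h0)
      obtain ⟨h1, h2⟩ := mem_torusSobolev_of_le_log hf hm ht hUc hVc hC
      have h3 : 2 * (2 * |r - s| / t / 2) * t = 2 * |r - s| := by field_simp
      have h4 := abs_nonneg (r - s)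
      have h5 := le_abs_self (r - s)
      rw [← add_sub_cancel s r]
      exact ⟨h1 _ (by linarith), h2 (1 / 2) (by norm_num) (by norm_num) _ (by linarith)⟩
    exact ⟨Set.mem_iInter.2 fun r => (key r).1, Set.mem_iInter.2 fun r => (key r).2⟩
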